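/- Let $b\in\mathbb C\setminus\{0,i,-i\}$ and let $S$ be the $\mathbb C$-algebra generated by $x_0,x_1,x_2,x_3$ subject to $$[x_0,x_1]=0,\quad \{x_0,x_1\}=[x_2,x_3],\quad [x_0,x_2]=b^2\{x_1,x_3\},\quad \{x_0,x_2\}=[x_3,x_1],\quad [x_0,x_3]=-b^2\{x_1,x_2\},\quad \{x_0,x_3\}=[x_1,x_2],$$ where $[x,y]=xy-yx$ and $\{x,y\}=xy+yx$, graded by $\deg x_j=1$; its degree-$n$ component is denoted $S_n$. Put $$q=\tfrac{1-ib}{1+ib},\quad \kappa=\tfrac{1}{q^{-1}-q},\quad E=\tfrac i2(1-ib)(x_2+ix_3),\quad F=\tfrac i2(1+ib)(x_2-ix_3),\quad K=x_0+bx_1,\quad K'=x_0-bx_1 .$$ The element $KK'$ is central in $S$. Let $U_q(\mathfrak{sl}_2)$ be the $\mathbb C$-algebra generated by $e,f,k^{\pm1}$ subject to $ke=q^2ek$, $kf=q^{-2}fk$, $kk^{-1}=k^{-1}k=1$, $[e,f]=\frac{k-k^{-1}}{q-q^{-1}}$, and for $\lambda\in\mathbb C$ let $M(\lambda)=U_q(\mathfrak{sl}_2)/\big(U_q(\mathfrak{sl}_2)e+U_q(\mathfrak{sl}_2)(k-\lambda)\big)$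 be the Verma module. For $\lambda\in\mathbb C\setminus\{0\}$ let $Q(\lambda)\subseteq\mathbb P(S_1^*)$ be the quadric $\kappa^{-2}EF+K^2-(\lambda+\lambda^{-1})KK'+K'^2=0$, and let $Q(0)=Q(\infty)$ be the quadric $KK'=0$. For a linear subspace $\ell$ of $\mathbb P(S_1^*)$ let $\ell^\perp\subseteq S_1$ be the space of linear forms vanishing on $\ell$. A line module is a graded left $S$-module that is cyclic, has Hilbert series $(1-t)^{-2}$, and is $2$-critical, i.e. it has Gelfand–Kirillov dimension $2$ and all its quotients by non-zero submodules have Gelfand–Kirillov dimension less than $2$. Let $\lambda\in\mathbb C\cup\{\infty\}=\mathbb P^1$ and let $\ell\subseteq\mathbb P(S_1^*)$ be given by $E=K-\lambda K'=0$ (for $\lambda=\infty$: $E=K'=0$). Then: 1. $\ell$ is a line, and it lies on the quadric $Q(\lambda)$. 2. $S/S\ell^\perp$ is a line module. 3. If $\lambda\notin\{0,\infty\}$, then for either square root $\sqrt q$ of $q$ there is an isomorphism of algebras $S[(KK')^{-1}]_0\cong U_q(\mathfrak{sl}_2)$ with $EK^{-1}\mapsto\sqrt q\,e$, $F(K')^{-1}\mapsto\sqrt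 q\,f$, $K(K')^{-1}\mapsto k$, and, along this isomorphism, the module $(S/S\ell^\perp)[(KK')^{-1}]_0$ is isomorphic to $M(\lambda)$. Here the subscript $0$ denotes the degree-zero component. -/

import Mathlib

open Complex

noncomputable section

/-! ### Gelfand-Kirillov dimension, critical modules, line modules -/

/-- The Gelfand-Kirillov dimension of a left module `M` over a `ℂ`-algebra `A`: the supremum over
all finite dimensional subspaces `V ∋ 1` of `A` and `W` of `M` of
`limsup (log (dim (V ^ n W)) / log n)`. -/
def gkDim (A M : Type*) [Ring A] [Algebra ℂ A] [AddCommGroup M] [Module ℂ M] [Module A M]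
    [IsScalarTower ℂ A M] : EReal :=
  ⨆ (V : Submodule ℂ A) (_ : (1 : A) ∈ V) (_ : FiniteDimensional ℂ V)
    (W : Submodule ℂ M) (_ : FiniteDimensional ℂ W),
    Filter.limsup
      (fun n : ℕ ↦ ((Real.log (Module.finrank ℂ ↥(V ^ n • W)) / Real.log n : ℝ) : EReal))
      Filter.atTop

/-- `M` is `d`-critical: it has GK-dimension `d`, and `M ⧸ N` has GK-dimension `< d` for every
non-zero submodule `N`. -/
def IsCriticalModule (d : ℕ) (A M : Type*) [Ring A] [Algebra ℂ A] [AddCommGroup M] [Module ℂ M]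
    [Module A M] [IsScalarTower ℂ A M] : Prop :=
  gkDim A M = d ∧ ∀ N : Submodule A M, N ≠ ⊥ → gkDim A (M ⧸ N) < d

/-- `M`, with homogeneous components `ℳ n` (`n ≥ 0`; the components of negative degree are zero),
is a line module over the algebra `A` with homogeneous components `𝒜 n`: it is a graded module, it
is cyclic and `2`-critical, and its Hilbert series is `(1 - t)⁻²`. -/
structure IsLineModule {A M : Type*} [Ring A] [Algebra ℂ A] [AddCommGroup M] [Module ℂ M]
    [Module A M] [IsScalarTower ℂ A M] (𝒜 : ℕ → Submodule ℂ A) (ℳ : ℕ → Submodule ℂ M) :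
    Prop where
  isInternal : DirectSum.IsInternal ℳ
  smul_mem : ∀ i j : ℕ, ∀ a ∈ 𝒜 i, ∀ m ∈ ℳ j, a • m ∈ ℳ (i + j)
  cyclic : ∃ m ∈ ℳ 0, Submodule.span A {m} = ⊤
  finiteDimensional : ∀ n, FiniteDimensional ℂ (ℳ n)
  hilbert : PowerSeries.mk (fun n ↦ (Module.finrank ℂ (ℳ n) : ℤ)) *
    (1 - (PowerSeries.X : PowerSeries ℤ)) ^ 2 = 1
  critical : IsCriticalModule 2 A M

/-! ### The algebra `S` -/

namespace DegSklyanin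

/-- The parameter `q = (1 - ib) / (1 + ib)`. -/
def q (b : ℂ) : ℂ := (1 - I * b) / (1 + I * b)

/-- The parameter `κ = 1 / (q⁻¹ - q)`. -/
def kappa (b : ℂ) : ℂ := 1 / ((q b)⁻¹ - q b)

/-- The free generators `x₀, x₁, x₂, x₃`. -/
abbrev X (i : Fin 4) : FreeAlgebra ℂ (Fin 4) := FreeAlgebra.ι ℂ i

/-- The defining relations of the degenerate Sklyanin algebra `S(0, b², -b²)`. -/
inductive Rel (b : ℂ) : FreeAlgebra ℂ (Fin 4) → FreeAlgebra ℂ (Fin 4) → Prop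
  | comm01 : Rel b (X 0 * X 1 - X 1 * X 0) 0
  | anti01 : Rel b (X 0 * X 1 + X 1 * X 0) (X 2 * X 3 - X 3 * X 2)
  | comm02 : Rel b (X 0 * X 2 - X 2 * X 0) (b ^ 2 • (X 1 * X 3 + X 3 * X 1))
  | anti02 : Rel b (X 0 * X 2 + X 2 * X 0) (X 3 * X 1 - X 1 * X 3)
  | comm03 : Rel b (X 0 * X 3 - X 3 * X 0) (-b ^ 2 • (X 1 * X 2 + X 2 * X 1))
  | anti03 : Rel b (X 0 * X 3 + X 3 * X 0) (X 1 * X 2 - X 2 * X 1)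

/-- The degenerate Sklyanin algebra `S = S(0, b², -b²)`. -/
def S (b : ℂ) : Type := RingQuot (Rel b)

instance (b : ℂ) : Ring (S b) := inferInstanceAs (Ring (RingQuot (Rel b)))

instance (b : ℂ) : Algebra ℂ (S b) := inferInstanceAs (Algebra ℂ (RingQuot (Rel b)))

/-- The quotient map from the free algebra. -/
def proj (b : ℂ) : FreeAlgebra ℂ (Fin 4) →ₐ[ℂ] S b := RingQuot.mkAlgHom ℂ (Rel b)

/-- The generators of `S`. -/
def x (b : ℂ) (i : Fin 4) : S b := proj b (X i)

/-- The degree-one component `S₁`. -/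
def S1 (b : ℂ) : Submodule ℂ (S b) := Submodule.span ℂ (Set.range (x b))

/-- The degree-`n` component of `S`, i.e. the span of the products of `n` generators. -/
def grading (b : ℂ) (n : ℕ) : Submodule ℂ (S b) := S1 b ^ n

lemma x_mem (b : ℂ) (i : Fin 4) : x b i ∈ S1 b := Submodule.subset_span ⟨i, rfl⟩

/-- The generators as elements of `S₁`. -/
def x1 (b : ℂ) (i : Fin 4) : S1 b := ⟨x b i, x_mem b i⟩

/-- `E = (i/2)(1 - ib)(x₂ + i x₃)`. -/
def E (b : ℂ) : S1 b := (I / 2 * (1 - I * b)) • (x1 b 2 + I • x1 b 3)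

/-- `F = (i/2)(1 + ib)(x₂ - i x₃)`. -/
def F (b : ℂ) : S1 b := (I / 2 * (1 + I * b)) • (x1 b 2 - I • x1 b 3)

/-- `K = x₀ + b x₁`. -/
def K (b : ℂ) : S1 b := x1 b 0 + b • x1 b 1

/-- `K' = x₀ - b x₁`. -/
def K' (b : ℂ) : S1 b := x1 b 0 - b • x1 b 1

/-! ### Lines and quadrics in `ℙ(S₁*)` -/

/-- The linear form `K - λ K'` (up to scalars) for `λ ∈ ℂ ∪ {∞}`; for `λ = ∞` this is `K'`. -/
def pencilForm (b : ℂ) : OnePoint ℂ → S1 b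
  | none => K' b
  | some μ => K b - μ • K' b

/-- The line `ℓ : E = K - λ K' = 0`, as a linear subspace of `S₁*`. -/
def line (b : ℂ) (lam : OnePoint ℂ) : Submodule ℂ (Module.Dual ℂ (S1 b)) where
  carrier := {ξ | ξ (E b) = 0 ∧ ξ (pencilForm b lam) = 0}
  add_mem' := fun hξ hη ↦ ⟨by simp [hξ.1, hη.1], by simp [hξ.2, hη.2]⟩
  zero_mem' := ⟨rfl, rfl⟩
  smul_mem' := fun _ _ hξ ↦ ⟨by simp [hξ.1], by simp [hξ.2]⟩

/-- The quadratic form `g_λ = κ⁻² E F + K² - (λ + λ⁻¹) K K' + K'²` on `S₁*`; for `λ = 0, ∞` it is,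
up to scalars, `K K'`. -/
def quadricForm (b : ℂ) (lam : OnePoint ℂ) (ξ : Module.Dual ℂ (S1 b)) : ℂ :=
  match lam with
  | none => ξ (K b) * ξ (K' b)
  | some μ =>
    if μ = 0 then ξ (K b) * ξ (K' b)
    else (kappa b ^ 2)⁻¹ * (ξ (E b) * ξ (F b)) + ξ (K b) ^ 2 - (μ + μ⁻¹) * (ξ (K b) * ξ (K' b)) +
      ξ (K' b) ^ 2

lemma quadricForm_smul (b : ℂ) (lam : OnePoint ℂ) (c : ℂ) (ξ : Module.Dual ℂ (S1 b)) :
    quadricForm b lam (c • ξ) = c ^ 2 * quadricForm b lam ξ := by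
  unfold quadricForm
  split
  · simp; ring
  · split_ifs <;> simp <;> ring

/-- The quadric `Q(λ) ⊆ ℙ(S₁*)`, the zero locus of `g_λ`. -/
def quadric (b : ℂ) (lam : OnePoint ℂ) : Set (Projectivization ℂ (Module.Dual ℂ (S1 b))) :=
  {p | quadricForm b lam p.rep = 0}

/-- Membership in `Q(λ)` does not depend on the representative of a point. -/
lemma mk_mem_quadric (b : ℂ) (lam : OnePoint ℂ) (ξ : Module.Dual ℂ (S1 b)) (hξ : ξ ≠ 0) :
    Projectivization.mk ℂ ξ hξ ∈ quadric b lam ↔ quadricForm b lam ξ = 0 := by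
  obtain ⟨a, ha⟩ := Projectivization.exists_smul_eq_mk_rep ℂ ξ hξ
  have ha' : (Projectivization.mk ℂ ξ hξ).rep = (a : ℂ) • ξ := ha.symm
  simp [quadric, ha', quadricForm_smul]

/-- For a linear subspace `V ⊆ S₁*`, the left ideal `S V^⊥` of `S`, where
`V^⊥ = {s ∈ S₁ | ξ s = 0 for all ξ ∈ V}`. -/
def perpIdeal (b : ℂ) (V : Submodule ℂ (Module.Dual ℂ (S1 b))) : Ideal (S b) :=
  Ideal.span (Subtype.val '' (V.dualCoannihilator : Set (S1 b)))

/-- The homogeneous components of `S ⧸ J`: the images of those of `S`. -/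
def quotGrading {b : ℂ} (J : Ideal (S b)) (n : ℕ) : Submodule ℂ (S b ⧸ J) :=
  (grading b n).map (J.mkQ.restrictScalars ℂ)

/-! ### The localization at the central element `K K'` -/

/-- The element `K K'` of `S`. -/
def c (b : ℂ) : S b := (K b : S b) * (K' b : S b)

lemma proj_rel {b : ℂ} {u v : FreeAlgebra ℂ (Fin 4)} (h : Rel b u v) : proj b u = proj b v :=
  RingQuot.mkAlgHom_rel ℂ h

lemma rel_comm01 (b : ℂ) : x b 0 * x b 1 - x b 1 * x b 0 = 0 := by
  simpa [x] using proj_rel (Rel.comm01 (b := b))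

lemma rel_comm02 (b : ℂ) :
    x b 0 * x b 2 - x b 2 * x b 0 = b ^ 2 • (x b 1 * x b 3 + x b 3 * x b 1) := by
  simpa [x] using proj_rel (Rel.comm02 (b := b))

lemma rel_anti02 (b : ℂ) :
    x b 0 * x b 2 + x b 2 * x b 0 = x b 3 * x b 1 - x b 1 * x b 3 := by
  simpa [x] using proj_rel (Rel.anti02 (b := b))

lemma rel_comm03 (b : ℂ) :
    x b 0 * x b 3 - x b 3 * x b 0 = -b ^ 2 • (x b 1 * x b 2 + x b 2 * x b 1) := by
  simpa [x] using proj_rel (Rel.comm03 (b := b))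

lemma rel_anti03 (b : ℂ) :
    x b 0 * x b 3 + x b 3 * x b 0 = x b 1 * x b 2 - x b 2 * x b 1 := by
  simpa [x] using proj_rel (Rel.anti03 (b := b))

lemma c_eq (b : ℂ) : c b = x b 0 * x b 0 - b ^ 2 • (x b 1 * x b 1) := by
  have h := sub_eq_zero.mp (rel_comm01 b)
  simp only [c, K, K', x1, Submodule.coe_add, Submodule.coe_sub, Submodule.coe_smul, add_mul,
    mul_sub, smul_mul_assoc, mul_smul_comm, h]
  module

lemma K'_mul_K (b : ℂ) : (K' b : S b) * (K b : S b) = c b := by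
  have h := sub_eq_zero.mp (rel_comm01 b)
  rw [c_eq]
  simp only [K, K', x1, Submodule.coe_add, Submodule.coe_sub, Submodule.coe_smul, mul_add,
    sub_mul, smul_mul_assoc, mul_smul_comm, h]
  module

lemma c_comm_x (b : ℂ) (i : Fin 4) : c b * x b i = x b i * c b := by
  have h01 := rel_comm01 b
  have h02 := rel_comm02 b
  have a02 := rel_anti02 b
  have h03 := rel_comm03 b
  have a03 := rel_anti03 b
  rw [c_eq, ← sub_eq_zero]
  rw [← sub_eq_zero] at h02 a02 h03 a03
  have key : ∀ x0 x1 x2 x3 : S b, x0 * x1 - x1 * x0 = 0 →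
      x0 * x2 - x2 * x0 - b ^ 2 • (x1 * x3 + x3 * x1) = 0 →
      x0 * x3 + x3 * x0 - (x1 * x2 - x2 * x1) = 0 →
      (x0 * x0 - b ^ 2 • (x1 * x1)) * x2 - x2 * (x0 * x0 - b ^ 2 • (x1 * x1)) = 0 := by
    intro x0 x1 x2 x3 h h2 a3
    have e : (x0 * x0 - b ^ 2 • (x1 * x1)) * x2 - x2 * (x0 * x0 - b ^ 2 • (x1 * x1)) =
        x0 * (x0 * x2 - x2 * x0 - b ^ 2 • (x1 * x3 + x3 * x1)) +
        (x0 * x2 - x2 * x0 - b ^ 2 • (x1 * x3 + x3 * x1)) * x0 +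
        b ^ 2 • (x1 * (x0 * x3 + x3 * x0 - (x1 * x2 - x2 * x1)) +
          (x0 * x3 + x3 * x0 - (x1 * x2 - x2 * x1)) * x1) +
        b ^ 2 • ((x0 * x1 - x1 * x0) * x3 - x3 * (x0 * x1 - x1 * x0)) := by
      simp only [mul_add, add_mul, mul_sub, sub_mul, smul_mul_assoc, mul_smul_comm, mul_assoc]
      module
    rw [e, h, h2, a3]
    simp
  fin_cases i
  · have h : x b 0 * x b 1 = x b 1 * x b 0 := sub_eq_zero.mp h01
    have h' : x b 0 * (x b 1 * x b 1) = x b 1 * x b 1 * x b 0 := by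
      rw [← mul_assoc, h, mul_assoc, h, mul_assoc]
    simp [sub_mul, mul_sub, mul_assoc, h']
  · have h : x b 0 * x b 1 = x b 1 * x b 0 := sub_eq_zero.mp h01
    have h' : x b 0 * (x b 0 * x b 1) = x b 1 * (x b 0 * x b 0) := by
      rw [h, ← mul_assoc, h, mul_assoc]
    simp [sub_mul, mul_sub, mul_assoc, h']
  · exact key _ _ _ _ h01 h02 a03
  · refine key (x b 0) (x b 1) (x b 3) (-x b 2) h01 ?_ ?_
    · refine Eq.trans ?_ h03; simp only [mul_neg, neg_mul]; module
    · refine Eq.trans ?_ (neg_eq_zero.mpr a02); simp only [mul_neg, neg_mul]; module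


lemma c_comm (b : ℂ) (s : S b) : c b * s = s * c b := by
  obtain ⟨u, rfl⟩ : ∃ u, proj b u = s := RingQuot.mkAlgHom_surjective ℂ (Rel b) s
  induction u using FreeAlgebra.induction with
  | grade0 r => rw [AlgHom.commutes]; exact (Algebra.commutes r (c b)).symm
  | grade1 i => exact c_comm_x b i
  | mul u v hu hv => rw [map_mul, ← mul_assoc, hu, mul_assoc, hv, mul_assoc]
  | add u v hu hv => rw [map_add, mul_add, add_mul, hu, hv]

/-- The multiplicative set `{(K K')ⁿ}`. -/
abbrev cPowers (b : ℂ) : Submonoid (S b) := Submonoid.powers (c b)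

lemma cPowers_comm (b : ℂ) (d : cPowers b) (s : S b) : (d : S b) * s = s * d := by
  obtain ⟨_, n, rfl⟩ := d
  exact (show Commute (c b) s from c_comm b s).pow_left n

/-- The powers of `K K'` form an Ore set, because `K K'` is central. -/
instance (b : ℂ) : OreLocalization.OreSet (cPowers b) where
  ore_right_cancel := fun r₁ r₂ s h ↦ ⟨s, by rw [cPowers_comm, cPowers_comm, h]⟩
  oreNum := fun r _ ↦ r
  oreDenom := fun _ s ↦ s
  ore_eq := fun r s ↦ cPowers_comm b s r

/-- The power `(K K')ⁿ` as a denominator. -/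
def cPow (b : ℂ) (n : ℕ) : cPowers b := ⟨c b ^ n, n, rfl⟩

/-- The localization `S[(K K')⁻¹]`. -/
abbrev SLoc (b : ℂ) : Type := OreLocalization (cPowers b) (S b)

/-- The localization `M[(K K')⁻¹]` of the module `M = S ⧸ J`. -/
abbrev quotLoc {b : ℂ} (J : Ideal (S b)) : Type := OreLocalization (cPowers b) (S b ⧸ J)

lemma cPow_add (b : ℂ) (m n : ℕ) : cPow b m * cPow b n = cPow b (m + n) :=
  Subtype.ext (pow_add (c b) m n).symm

lemma mul_mem_grading {b : ℂ} {i j : ℕ} {s t : S b} (hs : s ∈ grading b i)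
    (ht : t ∈ grading b j) : s * t ∈ grading b (i + j) := by
  unfold grading at *
  rw [pow_add]
  exact Submodule.mul_mem_mul hs ht

lemma mem_grading_one {b : ℂ} (s : S1 b) : (s : S b) ∈ grading b 1 := by
  unfold grading
  rw [pow_one]
  exact s.2

lemma cPow_mem (b : ℂ) (n : ℕ) : (cPow b n : S b) ∈ grading b (2 * n) := by
  induction n with
  | zero => simpa [cPow, grading] using ⟨1, map_one _⟩
  | succ n ih =>
    have : (cPow b (n + 1) : S b) = cPow b n * c b := pow_succ _ _
    rw [this, mul_add]
    exact mul_mem_grading ih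
      (mul_mem_grading (i := 1) (j := 1) (mem_grading_one _) (mem_grading_one _))

lemma smul_mem_quotGrading {b : ℂ} {J : Ideal (S b)} {i j : ℕ} {s : S b} {m : S b ⧸ J}
    (hs : s ∈ grading b i) (hm : m ∈ quotGrading J j) : s • m ∈ quotGrading J (i + j) := by
  obtain ⟨t, ht, rfl⟩ := hm
  exact ⟨s * t, mul_mem_grading hs ht, rfl⟩

lemma oreDiv_add_cPow {b : ℂ} {X : Type*} [AddCommGroup X] [Module (S b) X] (u v : X) (m n : ℕ) :
    (OreLocalization.oreDiv u (cPow b m) + OreLocalization.oreDiv v (cPow b n) :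
        OreLocalization (cPowers b) X) =
      OreLocalization.oreDiv ((cPow b n : S b) • u + (cPow b m : S b) • v) (cPow b (m + n)) := by
  rw [OreLocalization.oreDiv_add_char (cPow b m) (cPow b n) (cPow b m : S b) (cPow b n)
    (cPowers_comm b _ _), cPow_add, add_comm n m]
  rfl

lemma oreDiv_smul_cPow {b : ℂ} {X : Type*} [AddCommGroup X] [Module (S b) X] (s : S b) (v : X)
    (m n : ℕ) :
    (OreLocalization.oreDiv s (cPow b m) : SLoc b) •
        (OreLocalization.oreDiv v (cPow b n) : OreLocalization (cPowers b) X) =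
      OreLocalization.oreDiv (s • v) (cPow b (m + n)) := by
  rw [OreLocalization.oreDiv_smul_char s v (cPow b m) (cPow b n) s (cPow b n)
    (cPowers_comm b _ _), cPow_add, add_comm n m]

/-- The degree-zero component `S[(K K')⁻¹]₀`: the fractions `s / (K K')ⁿ` with `s` homogeneous of
degree `2n`. -/
def SLocZero (b : ℂ) : Subalgebra ℂ (SLoc b) where
  carrier := {y | ∃ n, ∃ s ∈ grading b (2 * n), y = OreLocalization.oreDiv s (cPow b n)}
  mul_mem' := by
    rintro _ _ ⟨m, s, hs, rfl⟩ ⟨n, t, ht, rfl⟩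
    refine ⟨m + n, s * t, ?_, oreDiv_smul_cPow s t m n⟩
    rw [mul_add]
    exact mul_mem_grading hs ht
  add_mem' := by
    rintro _ _ ⟨m, s, hs, rfl⟩ ⟨n, t, ht, rfl⟩
    refine ⟨m + n, _, ?_, oreDiv_add_cPow s t m n⟩
    refine Submodule.add_mem _ ?_ ?_
    · rw [add_comm, mul_add]
      exact mul_mem_grading (cPow_mem b n) hs
    · rw [mul_add]
      exact mul_mem_grading (cPow_mem b m) ht
  algebraMap_mem' := fun r ↦ by
    refine ⟨0, algebraMap ℂ (S b) r, ?_, ?_⟩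
    · simp [grading]
    · have : cPow b 0 = 1 := Subtype.ext (pow_zero _)
      rw [this]
      rfl

/-- The degree-zero component `M[(K K')⁻¹]₀` of the localization of `M = S ⧸ J`: the fractions
`m / (K K')ⁿ` with `m` homogeneous of degree `2n`. It is a module over `S[(K K')⁻¹]₀`. -/
def quotLocZero {b : ℂ} (J : Ideal (S b)) : Submodule (SLocZero b) (quotLoc J) where
  carrier := {y | ∃ n, ∃ m ∈ quotGrading J (2 * n), y = OreLocalization.oreDiv m (cPow b n)}
  add_mem' := by
    rintro _ _ ⟨m, s, hs, rfl⟩ ⟨n, t, ht, rfl⟩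
    refine ⟨m + n, _, ?_, oreDiv_add_cPow s t m n⟩
    refine Submodule.add_mem _ ?_ ?_
    · rw [add_comm, mul_add]
      exact smul_mem_quotGrading (cPow_mem b n) hs
    · rw [mul_add]
      exact smul_mem_quotGrading (cPow_mem b m) ht
  zero_mem' := ⟨0, 0, Submodule.zero_mem _, (OreLocalization.zero_oreDiv _).symm⟩
  smul_mem' := by
    rintro ⟨_, m, s, hs, rfl⟩ _ ⟨n, t, ht, rfl⟩
    refine ⟨m + n, s • t, ?_, oreDiv_smul_cPow s t m n⟩
    rw [mul_add]
    exact smul_mem_quotGrading hs ht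

instance {b : ℂ} (J : Ideal (S b)) : Module (SLocZero b) (quotLocZero J) :=
  Submodule.module (quotLocZero J)

instance {b : ℂ} (J : Ideal (S b)) : SMul (SLocZero b) (quotLocZero J) :=
  (Submodule.module (quotLocZero J)).toSMul

/-- The degree-zero fraction `s t / (K K')` for `s, t ∈ S₁`. -/
def frac (b : ℂ) (s t : S1 b) : SLocZero b :=
  ⟨OreLocalization.oreDiv ((s : S b) * t) (cPow b 1), 1, _,
    mul_mem_grading (i := 1) (j := 1) (mem_grading_one s) (mem_grading_one t), rfl⟩

/-- `E K⁻¹ = E K' (K K')⁻¹`. -/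
def EKinv (b : ℂ) : SLocZero b := frac b (E b) (K' b)

/-- `F K'⁻¹ = F K (K K')⁻¹`. -/
def FKinv' (b : ℂ) : SLocZero b := frac b (F b) (K b)

/-- `K K'⁻¹ = K K (K K')⁻¹`. -/
def KKinv' (b : ℂ) : SLocZero b := frac b (K b) (K b)

lemma oreDiv_mul_one_eq (b : ℂ) (u v w : S b) (h : u * v = w * c b) :
    (OreLocalization.oreDiv u (cPow b 1) : SLoc b) * OreLocalization.oreDiv v 1 =
      OreLocalization.oreDiv w 1 := by
  have h0 : (1 : cPowers b) = cPow b 0 := Subtype.ext (pow_zero _).symm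
  have h1 : (cPow b 1 : S b) = c b := pow_one _
  have h2 : (OreLocalization.oreDiv u (cPow b 1) : SLoc b) * OreLocalization.oreDiv v (cPow b 0) =
      OreLocalization.oreDiv (u * v) (cPow b (1 + 0)) := oreDiv_smul_cPow u v 1 0
  rw [h0, h2, h, OreLocalization.oreDiv_eq_iff]
  refine ⟨cPow b 1, 1, ?_, ?_⟩
  · simp [Submonoid.smul_def, h1, c_comm]
  · simp [cPow]

/-- `EKinv` is indeed `E K⁻¹`. -/
lemma EKinv_mul_K (b : ℂ) : (EKinv b : SLoc b) * OreLocalization.oreDiv (K b : S b) 1 =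
    OreLocalization.oreDiv (E b : S b) 1 :=
  oreDiv_mul_one_eq b _ _ _ (by rw [mul_assoc, K'_mul_K])

/-- `FKinv'` is indeed `F K'⁻¹`. -/
lemma FKinv'_mul_K' (b : ℂ) : (FKinv' b : SLoc b) * OreLocalization.oreDiv (K' b : S b) 1 =
    OreLocalization.oreDiv (F b : S b) 1 :=
  oreDiv_mul_one_eq b _ _ _ (by rw [mul_assoc]; rfl)

/-- `KKinv'` is indeed `K K'⁻¹`. -/
lemma KKinv'_mul_K' (b : ℂ) : (KKinv' b : SLoc b) * OreLocalization.oreDiv (K' b : S b) 1 =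
    OreLocalization.oreDiv (K b : S b) 1 :=
  oreDiv_mul_one_eq b _ _ _ (by rw [mul_assoc]; rfl)

end DegSklyanin

/-! ### The quantized enveloping algebra `U_q(sl₂)` and its Verma modules -/

namespace Uqsl2

/-- The names of the generators of `U_q(sl₂)`. -/
inductive Gen
  | e | f | k | kinv

/-- The free generators. -/
abbrev G (g : Gen) : FreeAlgebra ℂ Gen := FreeAlgebra.ι ℂ g

/-- The defining relations of `U_q(sl₂)`. -/
inductive Rel (q : ℂ) : FreeAlgebra ℂ Gen → FreeAlgebra ℂ Gen → Prop
  | ke : Rel q (G .k * G .e) (q ^ 2 • (G .e * G .k))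
  | kf : Rel q (G .k * G .f) ((q ^ 2)⁻¹ • (G .f * G .k))
  | k_kinv : Rel q (G .k * G .kinv) 1
  | kinv_k : Rel q (G .kinv * G .k) 1
  | ef : Rel q (G .e * G .f - G .f * G .e) ((q - q⁻¹)⁻¹ • (G .k - G .kinv))

end Uqsl2

/-- The quantized enveloping algebra `U_q(sl₂)`. -/
def Uqsl2 (q : ℂ) : Type := RingQuot (Uqsl2.Rel q)

namespace Uqsl2

instance (q : ℂ) : Ring (Uqsl2 q) := inferInstanceAs (Ring (RingQuot (Rel q)))

instance (q : ℂ) : Algebra ℂ (Uqsl2 q) := inferInstanceAs (Algebra ℂ (RingQuot (Rel q)))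

/-- The generators `e`, `f`, `k`, `k⁻¹` of `U_q(sl₂)`. -/
def gen (q : ℂ) (g : Gen) : Uqsl2 q := RingQuot.mkAlgHom ℂ (Rel q) (G g)

/-- The Verma module `M(λ) = U_q(sl₂) / (U_q(sl₂) e + U_q(sl₂) (k - λ))`. -/
abbrev Verma (q lam : ℂ) : Type :=
  Uqsl2 q ⧸ Ideal.span ({gen q .e, gen q .k - algebraMap ℂ (Uqsl2 q) lam} : Set (Uqsl2 q))

end Uqsl2

end

noncomputable section

/-! ### Presentation of `S` by `K`, `K'`, `E`, `F` -/

namespace DegSklyanin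

/-! After the linear change of generators to `K, K', E, F`, the algebra `S` is a homogenized quantum
`sl₂`: `K` and `K'` commute with each other and `q`-commute with `E` and `F`, and `[E, F]` is a
multiple of `K² - K'²` (`quantumRel`; `lift` is the converse universal property). Everything is
computed in this presentation.

The line: `E` and the pencil form are independent, so `ℓ` has codimension 2, and by biduality `ℓ^⊥`
is their span (`perpIdeal_line`). The quadric equation restricted to `ℓ` collapses.

The line module: let `T` be `K'` (or `K` when `λ = ∞`). Normal ordering modulo `S E + S (K - λ K')`
leaves only the monomials `Fᵃ Tᶜ`. The formulas that normal ordering forces define a representation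
of `S` on `ℂ[F, T]`, so the monomials are independent as well (`linearIndependent_monom`,
`span_monom`), and degree `n` has dimension `n + 1`. Criticality uses only that the module is free
of rank one over the quantum plane generated by `F` and `T` (`isCriticalModule_two`). A non-zero `m`
generates a free copy of this plane (`orbitMap_injective`), which already accounts for the quadratic
growth, so a quotient by a submodule containing `m` grows at most linearly.

The localization: `fromU` sends the generators of `U_q(sl₂)` to the prescribed fractions. It is onto
because every generator `q`-commutes with `K`, so denominators can be distributed over the factors
of a product. It is injective because `S` maps to the skew Laurent ring `U_q(sl₂)[K'^{±1}; σ]`, with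
`σ` conjugation by `K'`, realized concretely by operators on `U_q(sl₂)` (`skewRep`). There `K K'` is
invertible, the powers of `σ` cancel in degree zero, and the image of `u` is left multiplication by
`u` (`skewRepZero_fromU`).

The Verma module: the localized line module in degree zero is cyclic on the class of `1`, so only
the annihilator of that class is needed. The Verma ideal annihilates it by direct computation.
Conversely, the Verma ideal is stable under `skewRep` and contains `s · 1` for every `s` in the line
ideal, so nothing else annihilates it (`fromU_smul_vermaGen_eq_zero_iff`). -/

/-- The relations of `S` in terms of `K`, `K'`, `E`, `F`. -/
structure QuantumRel {A : Type*} [Ring A] [Algebra ℂ A] (q : ℂ) (k k' e f : A) : Prop where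
  kk' : k * k' = k' * k
  ke : k * e = q • (e * k)
  k'e : k' * e = q⁻¹ • (e * k')
  kf : k * f = q⁻¹ • (f * k)
  k'f : k' * f = q • (f * k')
  ef : e * f = f * e + (q - q⁻¹)⁻¹ • (k * k - k' * k')

lemma one_add_ne {b : ℂ} (hb : b ≠ I) : 1 + I * b ≠ 0 := fun h ↦
  hb (by linear_combination (-I) * h + b * I_sq)

lemma one_sub_ne {b : ℂ} (hb : b ≠ -I) : 1 - I * b ≠ 0 := fun h ↦
  hb (by linear_combination I * h + b * I_sq)

lemma q_ne_zero {b : ℂ} (hb₁ : b ≠ I) (hb₂ : b ≠ -I) : q b ≠ 0 :=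
  div_ne_zero (one_sub_ne hb₂) (one_add_ne hb₁)

/-- Since `q - q⁻¹ = -4ib / ((1 + ib)(1 - ib))`, the coefficient of `[E, F]` becomes explicit in
`b`, so that it can be compared with the original relations. -/
lemma q_sub_inv {b : ℂ} (hb₀ : b ≠ 0) (hb₁ : b ≠ I) (hb₂ : b ≠ -I) :
    (q b - (q b)⁻¹)⁻¹ = I * ((1 + I * b) * (1 - I * b)) / (4 * b) := by
  have h1 := one_add_ne hb₁
  have h2 := one_sub_ne hb₂
  have h : q b - (q b)⁻¹ = -(4 * I * b) / ((1 + I * b) * (1 - I * b)) := by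
    unfold q
    field_simp
    ring
  rw [h, inv_div]
  field_simp
  ring_nf
  simp only [I_sq]

theorem rel_anti01 (b : ℂ) :
    x b 0 * x b 1 + x b 1 * x b 0 = x b 2 * x b 3 - x b 3 * x b 2 := by
  simpa [x] using proj_rel (Rel.anti01 (b := b))

lemma E_coe (b : ℂ) : (E b : S b) = (I / 2 * (1 - I * b)) • (x b 2 + I • x b 3) := rfl
lemma F_coe (b : ℂ) : (F b : S b) = (I / 2 * (1 + I * b)) • (x b 2 - I • x b 3) := rfl
lemma K_coe (b : ℂ) : (K b : S b) = x b 0 + b • x b 1 := rfl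
lemma K'_coe (b : ℂ) : (K' b : S b) = x b 0 - b • x b 1 := rfl

/-- One identity serves all four `q`-commutation relations: `j = ±i` selects `E` or `F` up to a
scalar, and the sign of `b` selects `K` or `K'`. -/
theorem twisted_comm {A : Type*} [Ring A] [Algebra ℂ A] {b j : ℂ} (hj : j ^ 2 = -1)
    {x0 x1 x2 x3 : A}
    (c02 : x0 * x2 - x2 * x0 = b ^ 2 • (x1 * x3 + x3 * x1))
    (a02 : x0 * x2 + x2 * x0 = x3 * x1 - x1 * x3)
    (c03 : x0 * x3 - x3 * x0 = -b ^ 2 • (x1 * x2 + x2 * x1))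
    (a03 : x0 * x3 + x3 * x0 = x1 * x2 - x2 * x1) :
    (1 + j * b) • ((x0 + b • x1) * (x2 + j • x3)) =
      (1 - j * b) • ((x2 + j • x3) * (x0 + b • x1)) := by
  simp only [mul_add, add_mul, smul_mul_assoc, mul_smul_comm]
  linear_combination (norm := skip) c02 + j • c03 + (j * b) • a02 + (j * (j * b)) • a03
  match_scalars <;> grind

lemma smul_eq_div_smul {A : Type*} [AddCommGroup A] [Module ℂ A] {p m : ℂ} (hp : p ≠ 0) {u v : A}
    (h : p • u = m • v) : u = (m / p) • v := by
  rw [div_eq_inv_mul, mul_smul, ← h, inv_smul_smul₀ hp]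

theorem quantumRel (b : ℂ) (hb₀ : b ≠ 0) (hb₁ : b ≠ I) (hb₂ : b ≠ -I) :
    QuantumRel (q b) (K b : S b) (K' b : S b) (E b : S b) (F b : S b) := by
  have h1 := one_add_ne hb₁
  have h2 := one_sub_ne hb₂
  have c01 := rel_comm01 b
  have a01 := rel_anti01 b
  have c02 := rel_comm02 b
  have a02 := rel_anti02 b
  have c03 := rel_comm03 b
  have a03 := rel_anti03 b
  have hI : (-I) ^ 2 = -1 := by simp
  have hq : (q b)⁻¹ = (1 + I * b) / (1 - I * b) := inv_div _ _
  refine ⟨(K'_mul_K b).symm, ?_, ?_, ?_, ?_, ?_⟩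
  · have := smul_eq_div_smul h1 (twisted_comm I_sq c02 a02 c03 a03)
    rw [E_coe, K_coe, mul_smul_comm, smul_mul_assoc, this, smul_comm, q]
  -- The relations see `b` only through `b²`, so `b` may be replaced by `-b`, which exchanges `K`
  -- and `K'`.
  · rw [← neg_sq b] at c02 c03
    have := twisted_comm I_sq c02 a02 c03 a03
    rw [mul_neg, ← sub_eq_add_neg, sub_neg_eq_add, neg_smul, ← sub_eq_add_neg] at this
    have := smul_eq_div_smul h2 this
    rw [E_coe, K'_coe, mul_smul_comm, smul_mul_assoc, this, smul_comm, hq]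
  · have := twisted_comm hI c02 a02 c03 a03
    rw [neg_mul, ← sub_eq_add_neg, sub_neg_eq_add, neg_smul, ← sub_eq_add_neg] at this
    have := smul_eq_div_smul h2 this
    rw [F_coe, K_coe, mul_smul_comm, smul_mul_assoc, this, smul_comm, hq]
  · rw [← neg_sq b] at c02 c03
    have := twisted_comm hI c02 a02 c03 a03
    rw [neg_mul_neg, neg_smul, neg_smul, ← sub_eq_add_neg, ← sub_eq_add_neg] at this
    have := smul_eq_div_smul h1 this
    rw [F_coe, K'_coe, mul_smul_comm, smul_mul_assoc, this, smul_comm, q]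
  · rw [q_sub_inv hb₀ hb₁ hb₂, E_coe, F_coe, K_coe, K'_coe]
    simp only [mul_add, add_mul, mul_sub, sub_mul, smul_mul_assoc, mul_smul_comm]
    -- `[E, F]` is a multiple of `[x₂, x₃]` and `K² - K'² = 2b {x₀, x₁}`, so the relation `{x₀, x₁}
    -- = [x₂, x₃]` suffices.
    linear_combination (norm := skip) (-I / 2 * (1 - I * b) * (1 + I * b)) • a01
    match_scalars <;> field_simp <;> grind [I_sq]

/-! ### Universal property of `S` with respect to `K`, `K'`, `E`, `F` -/

section lift

variable {A : Type*} [Ring A] [Algebra ℂ A]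

/-- The images of the generators `x i` under `lift`. -/
def liftGen (b : ℂ) (k k' e f : A) : Fin 4 → A :=
  ![(2⁻¹ : ℂ) • (k + k'), (2 * b)⁻¹ • (k - k'),
    (-I * (1 - I * b)⁻¹) • e + (-I * (1 + I * b)⁻¹) • f,
    (-(1 - I * b)⁻¹) • e + (1 + I * b)⁻¹ • f]

theorem liftGen_rel {b : ℂ} (hb₀ : b ≠ 0) (hb₁ : b ≠ I) (hb₂ : b ≠ -I) {k k' e f : A}
    (h : QuantumRel (q b) k k' e f) {u v : FreeAlgebra ℂ (Fin 4)} (huv : Rel b u v) :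
    FreeAlgebra.lift ℂ (liftGen b k k' e f) u = FreeAlgebra.lift ℂ (liftGen b k k' e f) v := by
  have h1 := one_add_ne hb₁
  have h2 := one_sub_ne hb₂
  obtain ⟨r1, r2, r3, r4, r5, r6⟩ := h
  rw [q_sub_inv hb₀ hb₁ hb₂] at r6
  have hq : (q b)⁻¹ = (1 + I * b) / (1 - I * b) := inv_div _ _
  rw [hq] at r3 r4
  rw [q] at r2 r5
  unfold liftGen
  clear hb₁ hb₂ hq
  -- With `1 ± ib` and `i` made opaque, denominators clear and each coefficient is a polynomial
  -- identity modulo `hp`, `hm` and `i² = -1`.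
  generalize hp : 1 + I * b = p at *
  generalize hm : 1 - I * b = m at *
  have hI := I_sq
  generalize I = i at *
  induction huv <;>
  · simp only [map_sub, map_add, map_mul, map_smul, FreeAlgebra.lift_ι_apply, map_zero,
      Matrix.cons_val]
    simp only [mul_add, add_mul, mul_sub, sub_mul, smul_mul_assoc, mul_smul_comm, r1, r2, r3, r4,
      r5, r6]
    clear r1 r2 r3 r4 r5 r6
    match_scalars <;> field_simp <;> grind

/-- The algebra homomorphism out of `S` with prescribed values on `K`, `K'`, `E`, `F`. -/
def lift {b : ℂ} (hb₀ : b ≠ 0) (hb₁ : b ≠ I) (hb₂ : b ≠ -I) {k k' e f : A}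
    (h : QuantumRel (q b) k k' e f) : S b →ₐ[ℂ] A :=
  RingQuot.liftAlgHom ℂ ⟨FreeAlgebra.lift ℂ (liftGen b k k' e f),
    fun _ _ ↦ liftGen_rel hb₀ hb₁ hb₂ h⟩

variable {b : ℂ} (hb₀ : b ≠ 0) (hb₁ : b ≠ I) (hb₂ : b ≠ -I) {k k' e f : A}
    (h : QuantumRel (q b) k k' e f)

lemma lift_x (i : Fin 4) : lift hb₀ hb₁ hb₂ h (x b i) = liftGen b k k' e f i := by
  have := RingQuot.liftAlgHom_mkAlgHom_apply ℂ (FreeAlgebra.lift ℂ (liftGen b k k' e f))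
    (fun _ _ ↦ liftGen_rel hb₀ hb₁ hb₂ h) (X i)
  rw [FreeAlgebra.lift_ι_apply] at this
  exact this

lemma lift_K : lift hb₀ hb₁ hb₂ h (K b) = k := by
  simp only [K_coe, map_add, map_smul, lift_x, liftGen, Matrix.cons_val]
  match_scalars <;> field_simp <;> ring

lemma lift_K' : lift hb₀ hb₁ hb₂ h (K' b) = k' := by
  simp only [K'_coe, map_sub, map_smul, lift_x, liftGen, Matrix.cons_val]
  match_scalars <;> field_simp <;> ring

lemma lift_E : lift hb₀ hb₁ hb₂ h (E b) = e := by
  have h1 := one_add_ne hb₁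
  have h2 := one_sub_ne hb₂
  simp only [E_coe, map_add, map_smul, lift_x, liftGen, Matrix.cons_val]
  match_scalars <;> field_simp <;> grind [I_sq]

lemma lift_F : lift hb₀ hb₁ hb₂ h (F b) = f := by
  have h1 := one_add_ne hb₁
  have h2 := one_sub_ne hb₂
  simp only [F_coe, map_sub, map_smul, lift_x, liftGen, Matrix.cons_val]
  match_scalars <;> field_simp <;> grind [I_sq]

end lift

/-! ### Generation of `S` by `K`, `K'`, `E`, `F` -/

section generation

variable {b : ℂ}

/-- `liftGen` is the inverse of the linear substitution defining `K, K', E, F`. Hence linear and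
multiplicative statements about `S` need only be checked on these four elements. -/
lemma x_eq (hb₀ : b ≠ 0) (hb₁ : b ≠ I) (hb₂ : b ≠ -I) (i : Fin 4) :
    x1 b i = liftGen b (K b : S b) (K' b) (E b) (F b) i := by
  have h1 := one_add_ne hb₁
  have h2 := one_sub_ne hb₂
  fin_cases i <;> simp only [x1, E_coe, F_coe, K_coe, K'_coe, liftGen, Matrix.cons_val,
    Fin.zero_eta, Fin.mk_one, Fin.reduceFinMk] <;> match_scalars <;> field_simp <;> grind [I_sq]

theorem S1_le (hb₀ : b ≠ 0) (hb₁ : b ≠ I) (hb₂ : b ≠ -I) {N : Submodule ℂ (S b)}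
    (hK : (K b : S b) ∈ N) (hK' : (K' b : S b) ∈ N) (hE : (E b : S b) ∈ N)
    (hF : (F b : S b) ∈ N) : S1 b ≤ N := by
  rw [S1, Submodule.span_le]
  rintro _ ⟨i, rfl⟩
  change (x1 b i : S b) ∈ N
  rw [x_eq hb₀ hb₁ hb₂]
  fin_cases i <;> simp only [liftGen, Matrix.cons_val, Fin.zero_eta, Fin.mk_one, Fin.reduceFinMk]
  · exact N.smul_mem _ (N.add_mem hK hK')
  · exact N.smul_mem _ (N.sub_mem hK hK')
  · exact N.add_mem (N.smul_mem _ hE) (N.smul_mem _ hF)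
  · exact N.add_mem (N.smul_mem _ hE) (N.smul_mem _ hF)

theorem subalgebra_eq_top (hb₀ : b ≠ 0) (hb₁ : b ≠ I) (hb₂ : b ≠ -I) {B : Subalgebra ℂ (S b)}
    (hK : (K b : S b) ∈ B) (hK' : (K' b : S b) ∈ B) (hE : (E b : S b) ∈ B)
    (hF : (F b : S b) ∈ B) : B = ⊤ := by
  have hx : ∀ i, x b i ∈ B := fun i ↦
    S1_le (N := Subalgebra.toSubmodule B) hb₀ hb₁ hb₂ hK hK' hE hF (x_mem b i)
  rw [eq_top_iff]
  rintro s -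
  obtain ⟨u, rfl⟩ : ∃ u, proj b u = s := RingQuot.mkAlgHom_surjective ℂ (Rel b) s
  induction u using FreeAlgebra.induction with
  | grade0 r => rw [AlgHom.commutes]; exact B.algebraMap_mem r
  | grade1 i => exact hx i
  | mul u v hu hv => rw [map_mul]; exact B.mul_mem hu hv
  | add u v hu hv => rw [map_add]; exact B.add_mem hu hv

theorem adjoin_S1 (b : ℂ) : Algebra.adjoin ℂ (S1 b : Set (S b)) = ⊤ := by
  rw [eq_top_iff]
  rintro s -
  obtain ⟨u, rfl⟩ : ∃ u, proj b u = s := RingQuot.mkAlgHom_surjective ℂ (Rel b) s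
  induction u using FreeAlgebra.induction with
  | grade0 r => rw [AlgHom.commutes]; exact Subalgebra.algebraMap_mem _ r
  | grade1 i => exact Algebra.subset_adjoin (x_mem b i)
  | mul u v hu hv => rw [map_mul]; exact Subalgebra.mul_mem _ hu hv
  | add u v hu hv => rw [map_add]; exact Subalgebra.add_mem _ hu hv

end generation

/-! ### The line `ℓ` -/

/-- All the relations are homogeneous of degree two, so both sides vanish in a square-zero ideal.
The resulting map out of `S` detects the linear independence of the `xᵢ`. -/
lemma toTrivSqZeroExt_rel {b : ℂ} ⦃u v : FreeAlgebra ℂ (Fin 4)⦄ (h : Rel b u v) :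
    FreeAlgebra.lift ℂ (fun i ↦ (TrivSqZeroExt.inr (Pi.single i 1) : TrivSqZeroExt ℂ (Fin 4 → ℂ)))
      u = FreeAlgebra.lift ℂ (fun i ↦ TrivSqZeroExt.inr (Pi.single i 1)) v := by
  induction h <;> simp [FreeAlgebra.lift_ι_apply]

/-- The algebra homomorphism sending the generators to the canonical basis of a square-zero ideal. -/
def toTrivSqZeroExt (b : ℂ) : S b →ₐ[ℂ] TrivSqZeroExt ℂ (Fin 4 → ℂ) :=
  RingQuot.liftAlgHom ℂ ⟨FreeAlgebra.lift ℂ fun i ↦ TrivSqZeroExt.inr (Pi.single i 1),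
    toTrivSqZeroExt_rel⟩

lemma toTrivSqZeroExt_x (b : ℂ) (i : Fin 4) :
    toTrivSqZeroExt b (x b i) = TrivSqZeroExt.inr (Pi.single i 1) := by
  have := RingQuot.liftAlgHom_mkAlgHom_apply (s := Rel b) ℂ (FreeAlgebra.lift ℂ fun i ↦
    (TrivSqZeroExt.inr (Pi.single i 1) : TrivSqZeroExt ℂ (Fin 4 → ℂ)))
    toTrivSqZeroExt_rel (X i)
  rw [FreeAlgebra.lift_ι_apply] at this
  exact this

/-- The coordinates on `S₁` with respect to the generators. -/
def coords (b : ℂ) : S1 b →ₗ[ℂ] Fin 4 → ℂ :=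
  TrivSqZeroExt.sndHom ℂ _ ∘ₗ (toTrivSqZeroExt b).toLinearMap ∘ₗ (S1 b).subtype

lemma coords_x1 (b : ℂ) (i : Fin 4) : coords b (x1 b i) = Pi.single i 1 := by
  simp [coords, x1, toTrivSqZeroExt_x]

instance finiteDimensional_S1 (b : ℂ) : FiniteDimensional ℂ (S1 b) :=
  FiniteDimensional.span_of_finite ℂ (Set.finite_range _)

theorem finrank_S1 (b : ℂ) : Module.finrank ℂ (S1 b) = 4 := by
  have hli : LinearIndependent ℂ (x1 b) := by
    refine LinearIndependent.of_comp (coords b) ?_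
    have : coords b ∘ x1 b = Pi.basisFun ℂ (Fin 4) := by
      ext i; simp [coords_x1]
    rw [this]
    exact (Pi.basisFun ℂ (Fin 4)).linearIndependent
  have hli' : LinearIndependent ℂ (x b) :=
    hli.map' (S1 b).subtype (Submodule.ker_subtype _)
  exact (finrank_span_eq_card hli').trans (by simp)

/-- `E` involves only `x₂, x₃`, and the pencil form only `x₀, x₁`. The latter is non-zero: `K - μK'`
has coordinates `1 - μ` and `b(1 + μ)`, which cannot both vanish. -/
theorem linearIndependent_E_pencilForm {b : ℂ} (hb₀ : b ≠ 0) (hb₂ : b ≠ -I) (lam : OnePoint ℂ) :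
    LinearIndependent ℂ ![E b, pencilForm b lam] := by
  have h2 := one_sub_ne hb₂
  rw [LinearIndependent.pair_iff]
  intro s t h
  have hc := congrArg (coords b) h
  cases lam with
  | infty =>
    simp only [E, pencilForm, K', map_add, map_sub, map_smul, coords_x1, map_zero] at hc
    have h0 := congrFun hc 0
    have h2 := congrFun hc 2
    simp at h0 h2
    grind
  | coe μ =>
    simp only [E, pencilForm, K, K', map_add, map_sub, map_smul, coords_x1, map_zero] at hc
    have h0 := congrFun hc 0
    have h1 := congrFun hc 1
    have h2 := congrFun hc 2
    simp at h0 h1 h2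
    grind

theorem line_eq (b : ℂ) (lam : OnePoint ℂ) :
    line b lam = (Submodule.span ℂ (Set.range ![E b, pencilForm b lam])).dualAnnihilator := by
  ext ξ
  have : (∀ φ ∈ Set.range ![E b, pencilForm b lam], ξ φ = 0) ↔
      ξ (E b) = 0 ∧ ξ (pencilForm b lam) = 0 := by simp [and_comm]
  rw [Submodule.mem_dualAnnihilator]
  refine this.symm.trans ⟨fun h φ hφ ↦ ?_, fun h φ hφ ↦ h φ (Submodule.subset_span hφ)⟩
  exact (Submodule.span_le.mpr h : _ ≤ LinearMap.ker ξ) hφ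

theorem finrank_line {b : ℂ} (hb₀ : b ≠ 0) (hb₂ : b ≠ -I) (lam : OnePoint ℂ) :
    Module.finrank ℂ (line b lam) = 2 := by
  have h := Subspace.finrank_add_finrank_dualAnnihilator_eq
    (Submodule.span ℂ (Set.range ![E b, pencilForm b lam]))
  rw [finrank_span_eq_card (linearIndependent_E_pencilForm hb₀ hb₂ lam), finrank_S1,
    ← line_eq] at h
  simp at h
  omega

/-- Biduality for finite-dimensional spaces: the forms vanishing on an annihilator are the original
span. -/
theorem perpIdeal_line (b : ℂ) (lam : OnePoint ℂ) :
    perpIdeal b (line b lam) = Ideal.span {(E b : S b), (pencilForm b lam : S b)} := by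
  rw [perpIdeal, line_eq, Subspace.dualAnnihilator_dualCoannihilator_eq]
  apply le_antisymm
  · rw [Ideal.span_le]
    rintro _ ⟨s, hs, rfl⟩
    refine (Submodule.span_le (p := Submodule.comap (S1 b).subtype (Submodule.restrictScalars ℂ
      (Ideal.span {(E b : S b), (pencilForm b lam : S b)})))).mpr ?_ hs
    rintro _ ⟨i, rfl⟩
    apply Ideal.subset_span
    fin_cases i <;> simp
  · refine Ideal.span_mono ?_
    rintro _ (rfl | rfl)
    · exact ⟨_, Submodule.subset_span ⟨0, rfl⟩, rfl⟩
    · exact ⟨_, Submodule.subset_span ⟨1, rfl⟩, rfl⟩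

/-- On `ℓ` one has `E = 0` and `K = μK'`, which leaves `K'²(μ² - (μ + μ⁻¹)μ + 1) = 0`; for `μ = 0,
∞` one factor of `KK'` vanishes. -/
theorem mem_quadric_of_le_line {b : ℂ} {lam : OnePoint ℂ}
    {p : Projectivization ℂ (Module.Dual ℂ (S1 b))} (hp : p.submodule ≤ line b lam) :
    p ∈ quadric b lam := by
  have h : p.rep ∈ line b lam := hp (by
    rw [Projectivization.submodule_eq]; exact Submodule.mem_span_singleton_self _)
  obtain ⟨h1, h2⟩ : p.rep (E b) = 0 ∧ p.rep (pencilForm b lam) = 0 := h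
  change quadricForm b lam p.rep = 0
  cases lam with
  | infty =>
    change p.rep (K b) * p.rep (K' b) = 0
    rw [show p.rep (K' b) = 0 from h2, mul_zero]
  | coe μ =>
    have h3 : p.rep (K b) = μ * p.rep (K' b) := by
      rw [← sub_eq_zero, ← smul_eq_mul, ← map_smul, ← map_sub]
      exact h2
    change (if μ = 0 then _ else _) = 0
    split_ifs with hμ
    · rw [h3, hμ, zero_mul, zero_mul]
    · rw [h1, h3]
      field_simp
      ring

end DegSklyanin

/-! ### Estimating Gelfand-Kirillov dimensions -/

section gkDim

open Filter Topology

theorem Submodule.exists_le_of_monotone {M : Type*} [AddCommGroup M] [Module ℂ M]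
    {Q : ℕ → Submodule ℂ M} (hQ : Monotone Q) (V : Submodule ℂ M) [FiniteDimensional ℂ V]
    (h : ∀ v ∈ V, ∃ n, v ∈ Q n) : ∃ n, V ≤ Q n := by
  obtain ⟨s, hs⟩ := (Submodule.fg_top V).mp Module.Finite.fg_top
  choose! d hd using h
  refine ⟨s.sup d, ?_⟩
  rw [← hs, Submodule.span_le]
  intro v hv
  exact hQ (Finset.le_sup hv) (hd v (hs ▸ Submodule.subset_span hv))

/-- Multiplicative constants contribute `log C / log n → 0`, so only the exponent of a polynomial
bound matters for the GK-dimension. -/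
theorem tendsto_log_mul_pow_div_log {C : ℝ} (hC : 0 < C) (k : ℕ) :
    Tendsto (fun n : ℕ ↦ ((Real.log (C * (n : ℝ) ^ k) / Real.log n : ℝ) : EReal)) atTop
      (𝓝 ((k : ℝ) : EReal)) := by
  refine (continuous_coe_real_ereal.tendsto (k : ℝ)).comp ?_
  have h1 : Tendsto (fun n : ℕ ↦ Real.log C / Real.log n + k) atTop (𝓝 (0 + k)) :=
    (Tendsto.div_atTop tendsto_const_nhds
      (Real.tendsto_log_atTop.comp tendsto_natCast_atTop_atTop)).add_const _
  rw [zero_add] at h1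
  refine h1.congr' ?_
  filter_upwards [eventually_ge_atTop 2] with n hn
  have hn' : (1 : ℝ) < n := by exact_mod_cast hn
  have hl : 0 < Real.log n := Real.log_pos hn'
  rw [Real.log_mul hC.ne' (by positivity), Real.log_pow]
  field_simp

variable {A M : Type*} [Ring A] [Algebra ℂ A] [AddCommGroup M] [Module ℂ M]
    [Module A M] [IsScalarTower ℂ A M]

/-- An element of `A` is a noncommutative polynomial in `X`, hence raises the filtration by a
bounded amount. -/
theorem exists_smul_mem_filtration {X : Submodule ℂ A} (hX : Algebra.adjoin ℂ (X : Set A) = ⊤)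
    {P : ℕ → Submodule ℂ M} (hP : Monotone P) (hXP : ∀ n, ∀ x ∈ X, ∀ m ∈ P n, x • m ∈ P (n + 1))
    (a : A) : ∃ d, ∀ n, ∀ m ∈ P n, a • m ∈ P (n + d) := by
  have ha : a ∈ Algebra.adjoin ℂ (X : Set A) := hX ▸ Algebra.mem_top
  induction ha using Algebra.adjoin_induction with
  | mem x hx => exact ⟨1, fun n m hm ↦ hXP n x hx m hm⟩
  | algebraMap r => exact ⟨0, fun n m hm ↦ by
      rw [algebraMap_smul]; exact Submodule.smul_mem _ _ hm⟩
  | add a b _ _ iha ihb =>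
    obtain ⟨d, hd⟩ := iha
    obtain ⟨d', hd'⟩ := ihb
    refine ⟨d + d', fun n m hm ↦ ?_⟩
    rw [add_smul]
    exact Submodule.add_mem _ (hP (by omega) (hd n m hm)) (hP (by omega) (hd' n m hm))
  | mul a b _ _ iha ihb =>
    obtain ⟨d, hd⟩ := iha
    obtain ⟨d', hd'⟩ := ihb
    refine ⟨d' + d, fun n m hm ↦ ?_⟩
    rw [mul_smul, ← add_assoc]
    exact hd _ _ (hd' n m hm)

theorem pow_smul_le_filtration {P : ℕ → Submodule ℂ M} {V : Submodule ℂ A} {W : Submodule ℂ M}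
    {d w : ℕ} (hV : ∀ a ∈ V, ∀ n, ∀ m ∈ P n, a • m ∈ P (n + d)) (hW : W ≤ P w) (n : ℕ) :
    V ^ n • W ≤ P (w + n * d) := by
  induction n with
  | zero => rwa [pow_zero, Submodule.one_smul, zero_mul, add_zero]
  | succ n ih =>
    rw [pow_succ', ← smul_eq_mul, Submodule.smul_assoc, Submodule.smul_le]
    intro a ha m hm
    rw [show w + (n + 1) * d = w + n * d + d by ring]
    exact hV a ha _ m (ih hm)

/-- A module with a filtration of polynomial growth of degree `k` has GK-dimension at most `k`. -/
theorem gkDim_le_of_filtration {X : Submodule ℂ A} (hX : Algebra.adjoin ℂ (X : Set A) = ⊤)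
    {P : ℕ → Submodule ℂ M} (hP : Monotone P) [∀ n, FiniteDimensional ℂ (P n)]
    (hPtop : ∀ m, ∃ n, m ∈ P n)
    (hXP : ∀ n, ∀ x ∈ X, ∀ m ∈ P n, x • m ∈ P (n + 1)) (C k : ℕ)
    (hC : ∀ n, Module.finrank ℂ (P n) ≤ C * (n + 1) ^ k) : gkDim A M ≤ k := by
  refine iSup_le fun V ↦ iSup_le fun _ ↦ iSup_le fun _ ↦ iSup_le fun W ↦ iSup_le fun _ ↦ ?_
  -- `Q d` consists of the elements of filtration degree at most `d`; the finite-dimensional `V`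
  -- lies in one of them.
  let Q : ℕ → Submodule ℂ A := fun d ↦
    { carrier := {a | ∀ n, ∀ m ∈ P n, a • m ∈ P (n + d)}
      add_mem' := fun ha hb n m hm ↦ by
        rw [add_smul]; exact Submodule.add_mem _ (ha n m hm) (hb n m hm)
      zero_mem' := fun n m _ ↦ by rw [zero_smul]; exact Submodule.zero_mem _
      smul_mem' := fun c a ha n m hm ↦ by
        rw [smul_assoc]; exact Submodule.smul_mem _ _ (ha n m hm) }
  have hQ : Monotone Q := fun d d' hdd a ha n m hm ↦ hP (by omega) (ha n m hm)
  obtain ⟨d, hd⟩ := Submodule.exists_le_of_monotone hQ V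
    fun a _ ↦ exists_smul_mem_filtration hX hP hXP a
  obtain ⟨w, hw⟩ := Submodule.exists_le_of_monotone hP W fun m _ ↦ hPtop m
  have hVW := pow_smul_le_filtration (fun a ha n m hm ↦ hd ha n m hm) hw
  -- For `n ≥ 1`, `w + nd + 1 ≤ (w + d + 1) n`. Using `C + 1` instead of `C` keeps the constant at
  -- least `1`.
  have hD : (0 : ℝ) < (C + 1) * (w + d + 1) ^ k := by positivity
  rw [show ((k : ℕ) : EReal) = ((k : ℝ) : EReal) by simp,
    ← (tendsto_log_mul_pow_div_log hD k).limsup_eq]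
  refine limsup_le_limsup ?_
  filter_upwards [eventually_ge_atTop 1] with n hn
  rw [EReal.coe_le_coe_iff]
  refine div_le_div_of_nonneg_right ?_ (Real.log_natCast_nonneg n)
  have hn' : (1 : ℝ) ≤ n := by exact_mod_cast hn
  have hbound : (Module.finrank ℂ ↥(V ^ n • W) : ℝ) ≤ (C + 1) * (w + d + 1) ^ k * n ^ k := by
    have h1 := (Submodule.finrank_mono (hVW n)).trans (hC _)
    calc (Module.finrank ℂ ↥(V ^ n • W) : ℝ) ≤ C * ((w + n * d : ℕ) + 1) ^ k := by exact_mod_cast h1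
      _ ≤ (C + 1) * ((w + d + 1) * n) ^ k := by
        gcongr
        · linarith
        · push_cast
          nlinarith [(Nat.cast_nonneg w : (0 : ℝ) ≤ w), (Nat.cast_nonneg d : (0 : ℝ) ≤ d)]
      _ = _ := by rw [mul_pow]; ring
  -- In dimension zero `Real.log 0 = 0` by convention, so the bound must itself have non-negative
  -- logarithm.
  rcases Nat.eq_zero_or_pos (Module.finrank ℂ ↥(V ^ n • W)) with h0 | h0
  · rw [h0, Nat.cast_zero, Real.log_zero]
    refine Real.log_nonneg ?_
    have h2 : (1 : ℝ) ≤ (w + d + 1) ^ k := one_le_pow₀ (by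
      linarith [(Nat.cast_nonneg w : (0 : ℝ) ≤ w), (Nat.cast_nonneg d : (0 : ℝ) ≤ d)])
    have h3 : (1 : ℝ) ≤ (n : ℝ) ^ k := one_le_pow₀ hn'
    have h4 : (1 : ℝ) ≤ C + 1 := by linarith [(Nat.cast_nonneg C : (0 : ℝ) ≤ C)]
    exact one_le_mul_of_one_le_of_one_le (one_le_mul_of_one_le_of_one_le h4 h2) h3
  · exact Real.log_le_log (by exact_mod_cast h0) hbound

theorem le_gkDim {V : Submodule ℂ A} (h1 : (1 : A) ∈ V) [FiniteDimensional ℂ V]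
    {W : Submodule ℂ M} [FiniteDimensional ℂ W] {c : ℝ} (hc : 0 < c) (k : ℕ)
    (h : ∀ n : ℕ, c * n ^ k ≤ Module.finrank ℂ ↥(V ^ n • W)) : k ≤ gkDim A M := by
  refine le_trans ?_ (le_iSup_of_le V <| le_iSup_of_le h1 <| le_iSup_of_le ‹_› <|
    le_iSup_of_le W <| le_iSup_of_le ‹_› le_rfl)
  rw [show ((k : ℕ) : EReal) = ((k : ℝ) : EReal) by simp,
    ← (tendsto_log_mul_pow_div_log hc k).limsup_eq]
  refine limsup_le_limsup ?_
  filter_upwards [eventually_ge_atTop 1] with n hn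
  rw [EReal.coe_le_coe_iff]
  refine div_le_div_of_nonneg_right ?_ (Real.log_natCast_nonneg n)
  have hn' : (1 : ℝ) ≤ n := by exact_mod_cast hn
  exact Real.log_le_log (by positivity) (h n)

end gkDim

/-- Rank-nullity for `f` restricted to `P`, whose kernel contains a copy of `Q`. It bounds a
quotient's filtration by subtracting a known part of the submodule. -/
theorem Submodule.finrank_map_add_le {M N : Type*} [AddCommGroup M] [Module ℂ M] [AddCommGroup N]
    [Module ℂ N] (f : M →ₗ[ℂ] N) {P Q : Submodule ℂ M} [FiniteDimensional ℂ P] (hQP : Q ≤ P)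
    (hQ : Q ≤ LinearMap.ker f) :
    Module.finrank ℂ (P.map f) + Module.finrank ℂ Q ≤ Module.finrank ℂ P := by
  rw [← LinearMap.finrank_range_add_finrank_ker (f.domRestrict P), LinearMap.range_domRestrict]
  gcongr
  rw [← (Submodule.comapSubtypeEquivOfLe hQP).finrank_eq]
  exact Submodule.finrank_mono fun x hx ↦ hQ hx

/-! ### Modules that are free of rank one over a quantum plane -/

section plane

/-- The exponents `(a, c)` with `a + c ≤ n`. -/
def triangle (n : ℕ) : Finset (ℕ × ℕ) :=
  (Finset.range (n + 1)).biUnion Finset.HasAntidiagonal.antidiagonal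

lemma mem_triangle {n : ℕ} {p : ℕ × ℕ} : p ∈ triangle n ↔ p.1 + p.2 ≤ n := by
  simp [triangle]

lemma card_triangle (n : ℕ) : 2 * (triangle n).card = (n + 1) * (n + 2) := by
  rw [triangle, Finset.card_biUnion]
  · simp only [Finset.Nat.card_antidiagonal]
    induction n with
    | zero => simp
    | succ n ih => rw [Finset.sum_range_succ, mul_add, ih]; ring
  · intro i _ j _ hij
    rw [Function.onFun, Finset.disjoint_left]
    intro p hp hp'
    rw [Finset.HasAntidiagonal.mem_antidiagonal] at hp hp'
    omega

variable {M : Type*} [AddCommGroup M] [Module ℂ M]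

lemma finrank_span_image_basis {ι : Type*} (B : Module.Basis ι ℂ M) (s : Finset ι) :
    Module.finrank ℂ (Submodule.span ℂ (B '' s)) = s.card := by
  classical
  rw [← Finset.coe_image, finrank_span_finset_eq_card,
    Finset.card_image_of_injective _ B.injective]
  rw [Finset.coe_image]
  exact (B.linearIndependent.linearIndepOn_id).mono (Set.image_subset_range _ _)

/-- The span of the basis vectors of index `(a, c)` with `a + c ≤ n`. -/
def triangleSpan (B : Module.Basis (ℕ × ℕ) ℂ M) (n : ℕ) : Submodule ℂ M :=
  Submodule.span ℂ (B '' triangle n)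

variable (B : Module.Basis (ℕ × ℕ) ℂ M)

instance finiteDimensional_triangleSpan (n : ℕ) : FiniteDimensional ℂ (triangleSpan B n) :=
  FiniteDimensional.span_of_finite ℂ ((triangle n).finite_toSet.image B)

lemma finrank_triangleSpan (n : ℕ) :
    Module.finrank ℂ (triangleSpan B n) = (triangle n).card :=
  finrank_span_image_basis B _

lemma triangleSpan_mono : Monotone (triangleSpan B) := fun _ _ hmn ↦
  Submodule.span_mono (Set.image_mono fun _ hp ↦
    mem_triangle.mpr ((mem_triangle.mp hp).trans hmn))

lemma basis_mem_triangleSpan {p : ℕ × ℕ} {n : ℕ} (h : p.1 + p.2 ≤ n) : B p ∈ triangleSpan B n :=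
  Submodule.subset_span ⟨p, mem_triangle.mpr h, rfl⟩

lemma exists_mem_triangleSpan (m : M) : ∃ n, m ∈ triangleSpan B n := by
  refine ⟨(B.repr m).support.sup fun p ↦ p.1 + p.2, ?_⟩
  rw [triangleSpan, B.mem_span_image]
  intro p hp
  exact mem_triangle.mpr (Finset.le_sup (f := fun p : ℕ × ℕ ↦ p.1 + p.2) hp)

variable {A : Type*} [Ring A] [Algebra ℂ A] [Module A M] [IsScalarTower ℂ A M]

lemma smul_mem_triangleSpan {x : A} (h : ∀ p, x • B p ∈ triangleSpan B (p.1 + p.2 + 1)) {n : ℕ}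
    {m : M} (hm : m ∈ triangleSpan B n) : x • m ∈ triangleSpan B (n + 1) := by
  induction hm using Submodule.span_induction with
  | mem m hm =>
    obtain ⟨p, hp, rfl⟩ := hm
    exact triangleSpan_mono B (by have := mem_triangle.mp hp; omega) (h p)
  | zero => rw [smul_zero]; exact Submodule.zero_mem _
  | add m m' _ _ h h' => rw [smul_add]; exact Submodule.add_mem _ h h'
  | smul c m _ h => rw [smul_algebra_smul_comm]; exact Submodule.smul_mem _ _ h

variable {F T : A} {t : ℕ → ℂ}

lemma pow_smul_pow_smul_basis (hF : ∀ a c, F • B (a, c) = B (a + 1, c))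
    (hT : ∀ a c, T • B (a, c) = t a • B (a, c + 1)) (i j a c : ℕ) :
    F ^ i • T ^ j • B (a, c) = t a ^ j • B (i + a, j + c) := by
  have h1 : ∀ i a c, F ^ i • B (a, c) = B (i + a, c) := by
    intro i
    induction i with
    | zero => simp
    | succ i ih => intro a c; rw [pow_succ, mul_smul, hF, ih]; congr 2; ring
  have h2 : ∀ j a c, T ^ j • B (a, c) = t a ^ j • B (a, j + c) := by
    intro j
    induction j with
    | zero => simp
    | succ j ih => 
      intro a c
      rw [pow_succ, mul_smul, hT, smul_algebra_smul_comm, ih, smul_smul, ← pow_succ']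
      congr 3; ring
  rw [h2, smul_algebra_smul_comm, h1]

/-- The endomorphism `Fⁱ Tʲ ↦ Fⁱ Tʲ m`. -/
def orbitMap (F T : A) (m : M) : M →ₗ[ℂ] M := B.constr ℂ fun p ↦ F ^ p.1 • T ^ p.2 • m

omit [Algebra ℂ A] [IsScalarTower ℂ A M] in
lemma orbitMap_basis (F T : A) (m : M) (p : ℕ × ℕ) :
    orbitMap B F T m (B p) = F ^ p.1 • T ^ p.2 • m := by
  simp [orbitMap]

/-- The orbit map is a convolution on `ℕ × ℕ`, twisted by the scalars from moving `T` past powers of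
`F`. -/
lemma orbitMap_apply (hF : ∀ a c, F • B (a, c) = B (a + 1, c))
    (hT : ∀ a c, T • B (a, c) = t a • B (a, c + 1)) (m x : M) :
    orbitMap B F T m x = ∑ p ∈ (B.repr x).support, ∑ r ∈ (B.repr m).support,
      (B.repr x p * B.repr m r * t r.1 ^ p.2) • B (p + r) := by
  rw [orbitMap, Module.Basis.constr_apply, Finsupp.sum]
  refine Finset.sum_congr rfl fun p _ ↦ ?_
  conv_lhs => rw [← B.linearCombination_repr m, Finsupp.linearCombination_apply, Finsupp.sum]
  rw [Finset.smul_sum, Finset.smul_sum, Finset.smul_sum]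
  refine Finset.sum_congr rfl fun r _ ↦ ?_
  rw [smul_algebra_smul_comm, smul_algebra_smul_comm,
    show B r = B (r.1, r.2) from rfl, pow_smul_pow_smul_basis B hF hT, smul_smul, smul_smul]
  congr 1

/-- The argument that a quantum plane is a domain: `ℕ × ℕ` has unique sums, so some index `p + r`
arises from a single pair in the two supports, and its coefficient is a product of non-zero scalars.
-/
lemma orbitMap_injective (ht : ∀ a, t a ≠ 0) (hF : ∀ a c, F • B (a, c) = B (a + 1, c))
    (hT : ∀ a c, T • B (a, c) = t a • B (a, c + 1)) {m : M} (hm : m ≠ 0) :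
    Function.Injective (orbitMap B F T m) := by
  rw [injective_iff_map_eq_zero]
  intro x hx
  by_contra hx0
  have hm' : (B.repr m).support.Nonempty := by simpa using hm
  have hx' : (B.repr x).support.Nonempty := by simpa using hx0
  obtain ⟨p, hp, r, hr, hpr⟩ := UniqueSums.uniqueAdd_of_nonempty hx' hm'
  have h := congrArg (fun y ↦ B.repr y (p + r)) hx
  simp only [orbitMap_apply B hF hT, map_sum, map_smul, Finsupp.finsetSum_apply,
    Finsupp.smul_apply, Module.Basis.repr_self, smul_eq_mul, map_zero, Finsupp.zero_apply] at h
  rw [Finset.sum_eq_single_of_mem p hp, Finset.sum_eq_single_of_mem r hr] at h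
  · rw [Finsupp.single_eq_same] at h
    simp only [mul_one, mul_eq_zero, pow_eq_zero_iff', ht, false_and, or_false] at h
    rw [Finsupp.mem_support_iff] at hp hr
    tauto
  · intro r' hr' hne
    rw [Finsupp.single_eq_of_ne, mul_zero]
    exact fun h' ↦ hne (hpr hp hr' h'.symm).2
  · intro p' hp' hne
    refine Finset.sum_eq_zero fun r' hr' ↦ ?_
    rw [Finsupp.single_eq_of_ne, mul_zero]
    exact fun h' ↦ hne (hpr hp' hr' h'.symm).1

/-- The triangles `a + c ≤ n` have quadratic size, and their basis vectors are reached from `B (0,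
0)` by `n` steps, which gives dimension 2. If `0 ≠ m ∈ N` lies in level `d`, then `N` meets level `n
+ d` in dimension at least that of level `n`, and the difference of the two triangles is linear in
`n`. -/
theorem isCriticalModule_two {X : Submodule ℂ A} [FiniteDimensional ℂ X]
    (hX : Algebra.adjoin ℂ (X : Set A) = ⊤) (hFX : F ∈ X) (hTX : T ∈ X)
    (hXB : ∀ x ∈ X, ∀ p, x • B p ∈ triangleSpan B (p.1 + p.2 + 1))
    (ht : ∀ a, t a ≠ 0) (hF : ∀ a c, F • B (a, c) = B (a + 1, c))
    (hT : ∀ a c, T • B (a, c) = t a • B (a, c + 1)) : IsCriticalModule 2 A M := by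
  have hXP : ∀ n, ∀ x ∈ X, ∀ m ∈ triangleSpan B n, x • m ∈ triangleSpan B (n + 1) :=
    fun n x hx m hm ↦ smul_mem_triangleSpan B (hXB x hx) hm
  refine ⟨le_antisymm ?_ ?_, fun N hN ↦ ?_⟩
  · refine gkDim_le_of_filtration hX (triangleSpan_mono B) (exists_mem_triangleSpan B) hXP 1 2 ?_
    intro n
    rw [finrank_triangleSpan]
    nlinarith [card_triangle n]
  · have h1 : (1 : A) ∈ (1 ⊔ X : Submodule ℂ A) :=
      Submodule.mem_sup_left (Submodule.one_le.mp le_rfl)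
    have : FiniteDimensional ℂ (1 ⊔ X : Submodule ℂ A) := by
      have : FiniteDimensional ℂ (1 : Submodule ℂ A) := by
        rw [Submodule.one_eq_span]; infer_instance
      infer_instance
    refine le_gkDim (V := 1 ⊔ X) (W := Submodule.span ℂ {B (0, 0)}) h1 (c := 1 / 2) (by norm_num) 2
      fun n ↦ ?_
    have hle : triangleSpan B n ≤ (1 ⊔ X : Submodule ℂ A) ^ n • Submodule.span ℂ {B (0, 0)} := by
      rw [triangleSpan, Submodule.span_le]
      rintro _ ⟨⟨a, c⟩, hp, rfl⟩
      have hp' : a + c ≤ n := mem_triangle.mp hp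
      have key := pow_smul_pow_smul_basis B hF hT a c 0 0
      have : B (a, c) = ((t 0 ^ c)⁻¹ • (F ^ a * T ^ c)) • B (0, 0) := by
        rw [smul_assoc, mul_smul, key, inv_smul_smul₀ (pow_ne_zero _ (ht 0))]; simp
      rw [this]
      refine Submodule.smul_mem_smul ?_ (Submodule.mem_span_singleton_self _)
      have h2 : F ^ a * T ^ c ∈ (1 ⊔ X : Submodule ℂ A) ^ (a + c) := by
        rw [pow_add]
        exact Submodule.mul_mem_mul (Submodule.pow_mem_pow _ (Submodule.mem_sup_right hFX) _)
          (Submodule.pow_mem_pow _ (Submodule.mem_sup_right hTX) _)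
      have h3 : (1 ⊔ X) ^ (a + c) ≤ (1 ⊔ X) ^ n := pow_le_pow_right₀ le_sup_left hp'
      exact Submodule.smul_mem _ _ (h3 h2)
    -- Comparing `finrank`s by inclusion requires the larger space to be finite-dimensional.
    have hfin : FiniteDimensional ℂ ↥((1 ⊔ X : Submodule ℂ A) ^ n • Submodule.span ℂ {B (0, 0)}) := by
      refine Submodule.finiteDimensional_of_le (pow_smul_le_filtration (d := 1) (w := 0)
        (P := triangleSpan B) (fun a ha n m hm ↦ ?_) ?_ n)
      · obtain ⟨_, ⟨r, rfl⟩, x, hx, rfl⟩ := Submodule.mem_sup.mp ha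
        rw [add_smul]
        refine Submodule.add_mem _ (triangleSpan_mono B n.le_succ ?_) (hXP n x hx m hm)
        simpa using Submodule.smul_mem _ r hm
      · rw [Submodule.span_singleton_le_iff_mem]
        exact basis_mem_triangleSpan B le_rfl
    have h3 := Submodule.finrank_mono hle
    rw [finrank_triangleSpan] at h3
    have h4 : (triangle n).card * 2 ≥ n ^ 2 := by nlinarith [card_triangle n]
    have h5 : ((n : ℝ) ^ 2) ≤ (triangle n).card * 2 := by exact_mod_cast h4
    have h6 : ((triangle n).card : ℝ) ≤ Module.finrank ℂ
      ↥((1 ⊔ X : Submodule ℂ A) ^ n • Submodule.span ℂ {B (0, 0)}) := by exact_mod_cast h3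
    linarith
  · obtain ⟨m, hmN, hm⟩ := N.ne_bot_iff.mp hN
    obtain ⟨d, hd⟩ := exists_mem_triangleSpan B m
    let π : M →ₗ[ℂ] M ⧸ N := N.mkQ.restrictScalars ℂ
    have hmap : ∀ n, (triangleSpan B n).map (orbitMap B F T m) ≤ triangleSpan B (n + d) := by
      intro n
      rw [triangleSpan, Submodule.map_span_le]
      rintro _ ⟨p, hp, rfl⟩
      rw [orbitMap_basis]
      have hiter : ∀ x ∈ X, ∀ i n, ∀ y ∈ triangleSpan B n, x ^ i • y ∈ triangleSpan B (n + i) := by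
        intro x hx i
        induction i with
        | zero => simp
        | succ i ih =>
          intro n y hy
          rw [pow_succ', mul_smul]
          exact hXP _ x hx _ (ih n y hy)
      have := hiter F hFX p.1 _ _ (hiter T hTX p.2 _ _ hd)
      refine triangleSpan_mono B ?_ this
      have := mem_triangle.mp hp
      omega
    have hker : ∀ n, (triangleSpan B n).map (orbitMap B F T m) ≤ LinearMap.ker π := by
      intro n
      rw [triangleSpan, Submodule.map_span_le]
      rintro _ ⟨p, hp, rfl⟩
      rw [orbitMap_basis, LinearMap.mem_ker]
      exact (Submodule.Quotient.mk_eq_zero N).mpr (N.smul_mem _ (N.smul_mem _ hmN))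
    have hrank : ∀ n, Module.finrank ℂ ((triangleSpan B n).map (orbitMap B F T m)) =
        (triangle n).card := fun n ↦ by
      rw [← finrank_triangleSpan B n]
      exact ((triangleSpan B n).equivMapOfInjective _
        (orbitMap_injective B ht hF hT hm)).finrank_eq.symm
    have hle : gkDim A (M ⧸ N) ≤ (1 : ℕ) := by
      refine gkDim_le_of_filtration hX (P := fun n ↦ (triangleSpan B n).map π)
        (fun n n' h ↦ Submodule.map_mono (triangleSpan_mono B h)) ?_ ?_ (d + 1) 1 ?_
      · intro y
        obtain ⟨y, rfl⟩ := N.mkQ_surjective y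
        obtain ⟨n, hn⟩ := exists_mem_triangleSpan B y
        exact ⟨n, y, hn, rfl⟩
      · rintro n x hx _ ⟨y, hy, rfl⟩
        exact ⟨x • y, hXP n x hx y hy, rfl⟩
      · intro n
        have hc := card_triangle n
        -- For `n ≥ d` the difference of triangles is bounded by `(d + 1)(n + 1)`; for `n < d` the
        -- whole triangle already is.
        rcases le_or_gt d n with hdn | hdn
        · obtain ⟨e, rfl⟩ := Nat.exists_eq_add_of_le' hdn
          have h1 := Submodule.finrank_map_add_le π (hmap e) (hker e)
          rw [hrank, finrank_triangleSpan] at h1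
          have hc' := card_triangle e
          nlinarith
        · have h1 := Submodule.finrank_map_le π (triangleSpan B n)
          rw [finrank_triangleSpan] at h1
          nlinarith
    refine lt_of_le_of_lt hle ?_
    exact_mod_cast (by norm_num : (1 : ℕ) < 2)

end plane

namespace DegSklyanin

/-! ### The line modules -/

section lineRep

/-- The coefficient of `E` on the basis vector `(a, c)` of a line module. -/
def coefE (q α β : ℂ) (a : ℕ) : ℂ :=
  (q - q⁻¹)⁻¹ * ∑ j ∈ Finset.range a, ((α * q⁻¹ ^ j) ^ 2 - (β * q ^ j) ^ 2)

lemma coefE_zero (q α β : ℂ) : coefE q α β 0 = 0 := by simp [coefE]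

lemma coefE_succ (q α β : ℂ) (a : ℕ) : coefE q α β (a + 1) =
    coefE q α β a + (q - q⁻¹)⁻¹ * ((α * q⁻¹ ^ a) ^ 2 - (β * q ^ a) ^ 2) := by
  rw [coefE, coefE, Finset.sum_range_succ, mul_add]

/-- The canonical basis of `ℂ[F, T]`. -/
def vec (p : ℕ × ℕ) : ℕ × ℕ →₀ ℂ := Finsupp.single p 1

/-- The operator sending the basis vector of index `p` to `g p`. -/
def opOf (g : ℕ × ℕ → ℕ × ℕ →₀ ℂ) : Module.End ℂ (ℕ × ℕ →₀ ℂ) := Finsupp.linearCombination ℂ g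

lemma opOf_vec (g : ℕ × ℕ → ℕ × ℕ →₀ ℂ) (p : ℕ × ℕ) : opOf g (vec p) = g p := by
  simp [opOf, vec]

lemma op_ext {N : Type*} [AddCommGroup N] [Module ℂ N] {f g : (ℕ × ℕ →₀ ℂ) →ₗ[ℂ] N}
    (h : ∀ a c, f (vec (a, c)) = g (vec (a, c))) : f = g :=
  Finsupp.lhom_ext' fun p ↦ LinearMap.ext_ring (h p.1 p.2)

/-- The operators are those forced by normal ordering: passing `Fᵃ` costs `q^{∓a}`, and `coefE`
collects the commutators `[E, F]`. The truncated `p.1 - 1` at `p.1 = 0` is harmless because the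
coefficient vanishes there. -/
lemma lineRep_rel {q : ℂ} (hq : q ≠ 0) (α β : ℂ) : QuantumRel q
    (opOf fun p ↦ (α * q⁻¹ ^ p.1) • vec (p.1, p.2 + 1))
    (opOf fun p ↦ (β * q ^ p.1) • vec (p.1, p.2 + 1))
    (opOf fun p ↦ coefE q α β p.1 • vec (p.1 - 1, p.2 + 1 + 1))
    (opOf fun p ↦ vec (p.1 + 1, p.2)) := by
  constructor <;> refine op_ext fun a c ↦ ?_
  case kk' | kf | k'f =>
    simp only [Module.End.mul_apply, LinearMap.smul_apply, opOf_vec, map_smul]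
    match_scalars
    try simp only [inv_pow]
    field_simp
    try ring
  all_goals
    rcases a with - | a <;>
    simp only [Module.End.mul_apply, LinearMap.add_apply, LinearMap.sub_apply,
      LinearMap.smul_apply, opOf_vec, map_smul, coefE_zero, zero_smul, smul_zero,
      map_zero, Nat.add_sub_cancel]
  case ke.succ | k'e.succ =>
    match_scalars
    generalize coefE q α β (a + 1) = z
    try simp only [inv_pow]
    field_simp
    try ring
  all_goals
    rw [coefE_succ]
    try rw [coefE_zero]
    match_scalars
    ring

variable {b : ℂ} (hb₀ : b ≠ 0) (hb₁ : b ≠ I) (hb₂ : b ≠ -I)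

/-- The representation of `S` on `ℂ[F, T]` in which `K` and `K'` act on the first column as `α T`
and `β T`. -/
def lineRep (α β : ℂ) : S b →ₐ[ℂ] Module.End ℂ (ℕ × ℕ →₀ ℂ) :=
  lift hb₀ hb₁ hb₂ (lineRep_rel (q_ne_zero hb₁ hb₂) α β)

lemma lineRep_K (α β : ℂ) (a c : ℕ) : lineRep hb₀ hb₁ hb₂ α β (K b) (vec (a, c)) =
    (α * (q b)⁻¹ ^ a) • vec (a, c + 1) := by rw [lineRep, lift_K, opOf_vec]

lemma lineRep_K' (α β : ℂ) (a c : ℕ) : lineRep hb₀ hb₁ hb₂ α β (K' b) (vec (a, c)) =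
    (β * q b ^ a) • vec (a, c + 1) := by rw [lineRep, lift_K', opOf_vec]

lemma lineRep_E (α β : ℂ) (a c : ℕ) : lineRep hb₀ hb₁ hb₂ α β (E b) (vec (a, c)) =
    coefE (q b) α β a • vec (a - 1, c + 1 + 1) := by rw [lineRep, lift_E, opOf_vec]

lemma lineRep_F (α β : ℂ) (a c : ℕ) : lineRep hb₀ hb₁ hb₂ α β (F b) (vec (a, c)) =
    vec (a + 1, c) := by rw [lineRep, lift_F, opOf_vec]

end lineRep

/-- The left ideal `S E + S (K - λ K')`. -/
abbrev lineIdeal (b : ℂ) (lam : OnePoint ℂ) : Ideal (S b) :=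
  Ideal.span {(E b : S b), (pencilForm b lam : S b)}

/-- A linear form that, together with `E` and `K - λ K'`, spans all of `K`, `K'`, `E`. -/
def compl (b : ℂ) : OnePoint ℂ → S1 b
  | none => K b
  | some _ => K' b

/-- The scalar `α` with `K ≡ α T` modulo `K - λ K'`. -/
def scalK : OnePoint ℂ → ℂ
  | none => 1
  | some μ => μ

/-- The scalar `β` with `K' ≡ β T` modulo `K - λ K'`. -/
def scalK' : OnePoint ℂ → ℂ
  | none => 0
  | some _ => 1

/-- The commutation factor between `T` and `F`. -/
def scalF (q : ℂ) : OnePoint ℂ → ℂ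
  | none => q⁻¹
  | some _ => q

/-- The image of `Fᵃ Tᶜ` in the line module. -/
def monom (b : ℂ) (lam : OnePoint ℂ) (p : ℕ × ℕ) : S b ⧸ lineIdeal b lam :=
  Submodule.Quotient.mk ((F b : S b) ^ p.1 * (compl b lam : S b) ^ p.2)

lemma pow_smul_comm {A : Type*} [Ring A] [Algebra ℂ A] {u v : A} {z : ℂ} (h : u * v = z • (v * u))
    (n : ℕ) : u * v ^ n = z ^ n • (v ^ n * u) := by
  induction n with
  | zero => simp
  | succ n ih =>
    rw [pow_succ, ← mul_assoc, ih, smul_mul_assoc, mul_assoc, h, mul_smul_comm, smul_smul,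
      ← mul_assoc, ← pow_succ]

/-! ### The basis `Fᵃ Tᶜ` of the line module -/

section lineBasis

variable {b : ℂ} (hb₀ : b ≠ 0) (hb₁ : b ≠ I) (hb₂ : b ≠ -I) (lam : OnePoint ℂ)

lemma mk_E : (Submodule.Quotient.mk (E b : S b) : S b ⧸ lineIdeal b lam) = 0 :=
  (Submodule.Quotient.mk_eq_zero _).mpr (Ideal.subset_span (by simp))

lemma mk_pencilForm :
    (Submodule.Quotient.mk (pencilForm b lam : S b) : S b ⧸ lineIdeal b lam) = 0 :=
  (Submodule.Quotient.mk_eq_zero _).mpr (Ideal.subset_span (by simp))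

lemma mk_K : (Submodule.Quotient.mk (K b : S b) : S b ⧸ lineIdeal b lam) =
    scalK lam • Submodule.Quotient.mk (compl b lam : S b) := by
  cases lam with
  | infty => exact (one_smul ℂ _).symm
  | coe μ => exact sub_eq_zero.mp (mk_pencilForm (b := b) (μ : OnePoint ℂ))

lemma mk_K' : (Submodule.Quotient.mk (K' b : S b) : S b ⧸ lineIdeal b lam) =
    scalK' lam • Submodule.Quotient.mk (compl b lam : S b) := by
  cases lam with
  | infty => exact (mk_pencilForm (b := b) _).trans (zero_smul ℂ _).symm
  | coe μ => exact (one_smul ℂ _).symm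

lemma commute_K_compl : Commute (K b : S b) (compl b lam) := by
  cases lam with
  | infty => exact Commute.refl _
  | coe μ => exact (K'_mul_K b).symm

lemma commute_K'_compl : Commute (K' b : S b) (compl b lam) := by
  cases lam with
  | infty => exact K'_mul_K b
  | coe μ => exact Commute.refl _

include hb₀ hb₁ hb₂

lemma E_mul_compl : ∃ z : ℂ, (E b : S b) * compl b lam = z • ((compl b lam : S b) * E b) := by
  have h := quantumRel b hb₀ hb₁ hb₂
  have hq := q_ne_zero hb₁ hb₂
  cases lam with
  | infty =>
    refine ⟨(q b)⁻¹, ?_⟩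
    change (E b : S b) * K b = _ • ((K b : S b) * E b)
    rw [h.ke, inv_smul_smul₀ hq]
  | coe μ =>
    refine ⟨q b, ?_⟩
    change (E b : S b) * K' b = _ • ((K' b : S b) * E b)
    rw [h.k'e, smul_inv_smul₀ hq]

/-- `K` is moved to the right end of the monomial, where the left ideal allows replacing it by a
multiple of `T`. -/
lemma K_smul_monom (a c : ℕ) : (K b : S b) • monom b lam (a, c) =
    (scalK lam * (q b)⁻¹ ^ a) • monom b lam (a, c + 1) := by
  have h := quantumRel b hb₀ hb₁ hb₂
  calc (K b : S b) • monom b lam (a, c) =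
      Submodule.Quotient.mk ((K b : S b) * (F b : S b) ^ a * (compl b lam : S b) ^ c) := by
        rw [mul_assoc]; rfl
    _ = Submodule.Quotient.mk ((q b)⁻¹ ^ a • ((F b : S b) ^ a * (compl b lam : S b) ^ c * K b)) := by
        rw [pow_smul_comm h.kf, smul_mul_assoc, mul_assoc,
          ((commute_K_compl lam).pow_right c).eq, mul_assoc]
    _ = (q b)⁻¹ ^ a • ((F b : S b) ^ a * (compl b lam : S b) ^ c) •
          (Submodule.Quotient.mk (K b : S b) : S b ⧸ lineIdeal b lam) := rfl
    _ = (scalK lam * (q b)⁻¹ ^ a) • Submodule.Quotient.mk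
          ((F b : S b) ^ a * (compl b lam : S b) ^ c * compl b lam) := by
        rw [mk_K, smul_algebra_smul_comm, smul_smul, mul_comm]; rfl
    _ = _ := by rw [mul_assoc, ← pow_succ]; rfl

lemma K'_smul_monom (a c : ℕ) : (K' b : S b) • monom b lam (a, c) =
    (scalK' lam * q b ^ a) • monom b lam (a, c + 1) := by
  have h := quantumRel b hb₀ hb₁ hb₂
  calc (K' b : S b) • monom b lam (a, c) =
      Submodule.Quotient.mk ((K' b : S b) * (F b : S b) ^ a * (compl b lam : S b) ^ c) := by
        rw [mul_assoc]; rfl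
    _ = Submodule.Quotient.mk (q b ^ a • ((F b : S b) ^ a * (compl b lam : S b) ^ c * K' b)) := by
        rw [pow_smul_comm h.k'f, smul_mul_assoc, mul_assoc,
          ((commute_K'_compl lam).pow_right c).eq, mul_assoc]
    _ = q b ^ a • ((F b : S b) ^ a * (compl b lam : S b) ^ c) •
          (Submodule.Quotient.mk (K' b : S b) : S b ⧸ lineIdeal b lam) := rfl
    _ = (scalK' lam * q b ^ a) • Submodule.Quotient.mk
          ((F b : S b) ^ a * (compl b lam : S b) ^ c * compl b lam) := by
        rw [mk_K', smul_algebra_smul_comm, smul_smul, mul_comm]; rfl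
    _ = _ := by rw [mul_assoc, ← pow_succ]; rfl

omit hb₀ hb₁ hb₂ in
lemma F_smul_monom (a c : ℕ) : (F b : S b) • monom b lam (a, c) = monom b lam (a + 1, c) := by
  rw [monom, monom, ← Submodule.Quotient.mk_smul, smul_eq_mul, ← mul_assoc, ← pow_succ']

/-- Induction on `a`: at `a = 0`, `E` moves past `Tᶜ` up to a scalar and dies; each further `F`
contributes one commutator. -/
lemma E_smul_monom (a c : ℕ) : (E b : S b) • monom b lam (a, c) =
    coefE (q b) (scalK lam) (scalK' lam) a • monom b lam (a - 1, c + 1 + 1) := by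
  have h := quantumRel b hb₀ hb₁ hb₂
  induction a with
  | zero =>
    obtain ⟨z, hz⟩ := E_mul_compl hb₀ hb₁ hb₂ lam
    rw [coefE_zero, zero_smul]
    calc (E b : S b) • monom b lam (0, c) =
        Submodule.Quotient.mk ((E b : S b) * (compl b lam : S b) ^ c) := by
          rw [monom, pow_zero, one_mul]; rfl
      _ = z ^ c • (compl b lam : S b) ^ c •
          (Submodule.Quotient.mk (E b : S b) : S b ⧸ lineIdeal b lam) := by
          rw [pow_smul_comm hz]; rfl
      _ = 0 := by rw [mk_E, smul_zero, smul_zero]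
  | succ a ih =>
    rw [← F_smul_monom, ← mul_smul, h.ef, add_smul, mul_smul, ih, smul_algebra_smul_comm,
      F_smul_monom, smul_assoc, sub_smul, mul_smul, mul_smul, K_smul_monom hb₀ hb₁ hb₂,
      K'_smul_monom hb₀ hb₁ hb₂, smul_algebra_smul_comm, smul_algebra_smul_comm,
      K_smul_monom hb₀ hb₁ hb₂, K'_smul_monom hb₀ hb₁ hb₂, coefE_succ, Nat.add_sub_cancel]
    -- The term `F E` has index `(a - 1) + 1`, which equals `a` only for `a > 0`; at `a = 0` its
    -- coefficient is zero.
    rcases a with - | a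
    · rw [coefE_zero, zero_smul, zero_add]
      match_scalars
      ring
    · rw [Nat.add_sub_cancel]
      match_scalars
      ring

/-- The comparison map from the model `ℂ[F, T]` to the quotient is `S`-linear: the elements it
intertwines form a subalgebra containing the four generators. -/
lemma linearCombination_monom_lineRep (s : S b) (w : ℕ × ℕ →₀ ℂ) :
    Finsupp.linearCombination ℂ (monom b lam)
      (lineRep hb₀ hb₁ hb₂ (scalK lam) (scalK' lam) s w) =
    s • Finsupp.linearCombination ℂ (monom b lam) w := by
  have hv : ∀ p, Finsupp.linearCombination ℂ (monom b lam) (vec p) = monom b lam p := fun p ↦ by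
    simp [vec]
  let ρ := lineRep hb₀ hb₁ hb₂ (scalK lam) (scalK' lam)
  let B : Subalgebra ℂ (S b) :=
    { carrier := {s | ∀ w, Finsupp.linearCombination ℂ (monom b lam) (ρ s w) =
        s • Finsupp.linearCombination ℂ (monom b lam) w}
      mul_mem' := fun {s t} hs ht w ↦ by
        rw [map_mul, Module.End.mul_apply, hs, ht, mul_smul]
      add_mem' := fun {s t} hs ht w ↦ by
        rw [map_add, LinearMap.add_apply, map_add, hs, ht, add_smul]
      algebraMap_mem' := fun r w ↦ by
        rw [AlgHom.commutes, Module.algebraMap_end_apply, map_smul, algebraMap_smul] }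
  have key : ∀ s : S b, (∀ a c, Finsupp.linearCombination ℂ (monom b lam) (ρ s (vec (a, c))) =
      s • monom b lam (a, c)) → s ∈ B := by
    intro s hs w
    refine LinearMap.congr_fun (f := Finsupp.linearCombination ℂ (monom b lam) ∘ₗ ρ s)
      (g := Module.toModuleEnd ℂ (S b ⧸ lineIdeal b lam) s ∘ₗ
        Finsupp.linearCombination ℂ (monom b lam)) (op_ext fun a c ↦ ?_) w
    refine (hs a c).trans ?_
    rw [← hv]
    rfl
  have hB : B = ⊤ := by
    refine subalgebra_eq_top hb₀ hb₁ hb₂ (key _ ?_) (key _ ?_) (key _ ?_) (key _ ?_) <;> intro a c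
    · rw [lineRep_K, map_smul, hv, K_smul_monom hb₀ hb₁ hb₂]
    · rw [lineRep_K', map_smul, hv, K'_smul_monom hb₀ hb₁ hb₂]
    · rw [lineRep_E, map_smul, hv, E_smul_monom hb₀ hb₁ hb₂]
    · rw [lineRep_F, hv, F_smul_monom]
  exact (hB ▸ Algebra.mem_top : s ∈ B) w

lemma lineRep_compl (a c : ℕ) :
    lineRep hb₀ hb₁ hb₂ (scalK lam) (scalK' lam) (compl b lam) (vec (a, c)) =
      scalF (q b) lam ^ a • vec (a, c + 1) := by
  cases lam with
  | infty => exact (lineRep_K hb₀ hb₁ hb₂ _ _ a c).trans (by simp [scalK, scalF])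
  | coe μ => exact (lineRep_K' hb₀ hb₁ hb₂ _ _ a c).trans (by simp [scalK', scalF])

lemma lineRep_monom (p : ℕ × ℕ) :
    lineRep hb₀ hb₁ hb₂ (scalK lam) (scalK' lam) ((F b : S b) ^ p.1 * (compl b lam : S b) ^ p.2)
      (vec (0, 0)) = vec p := by
  obtain ⟨a, c⟩ := p
  rw [map_mul, Module.End.mul_apply, map_pow, map_pow]
  have hc : (lineRep hb₀ hb₁ hb₂ (scalK lam) (scalK' lam) (compl b lam : S b) ^ c) (vec (0, 0)) =
      vec (0, c) := by
    induction c with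
    | zero => rfl
    | succ c ih => rw [pow_succ', Module.End.mul_apply, ih, lineRep_compl, pow_zero, one_smul]
  rw [hc]
  induction a with
  | zero => rfl
  | succ a ih => rw [pow_succ', Module.End.mul_apply, ih, lineRep_F]

lemma lineRep_eq_zero {s : S b} (hs : s ∈ lineIdeal b lam) :
    lineRep hb₀ hb₁ hb₂ (scalK lam) (scalK' lam) s (vec (0, 0)) = 0 := by
  induction hs using Submodule.span_induction with
  | mem s hs =>
    rcases hs with rfl | rfl
    · rw [lineRep_E, coefE_zero, zero_smul]
    · cases lam with
      | infty => exact (lineRep_K' hb₀ hb₁ hb₂ _ _ 0 0).trans (by simp [scalK'])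
      | coe μ =>
        change lineRep hb₀ hb₁ hb₂ μ 1 ((K b : S b) - μ • (K' b : S b)) _ = 0
        rw [map_sub, map_smul, LinearMap.sub_apply, LinearMap.smul_apply, lineRep_K, lineRep_K']
        simp
  | zero => rw [map_zero, LinearMap.zero_apply]
  | add s t _ _ hs ht => rw [map_add, LinearMap.add_apply, hs, ht, add_zero]
  | smul r s _ hs => rw [smul_eq_mul, map_mul, Module.End.mul_apply, hs, map_zero]

/-- Acting on `vec (0, 0)` kills the line ideal and sends `Fᵃ Tᶜ` to `vec (a, c)`, so a relation
among the monomials becomes one among basis vectors. -/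
theorem linearIndependent_monom : LinearIndependent ℂ (monom b lam) := by
  rw [linearIndependent_iff]
  intro l hl
  let f : S b →ₗ[ℂ] S b ⧸ lineIdeal b lam := (lineIdeal b lam).mkQ.restrictScalars ℂ
  let g : ℕ × ℕ → S b := fun p ↦ (F b : S b) ^ p.1 * (compl b lam : S b) ^ p.2
  have h1 : f (Finsupp.linearCombination ℂ g l) = 0 := by
    rw [← hl, Finsupp.apply_linearCombination]
    rfl
  have h2 := lineRep_eq_zero hb₀ hb₁ hb₂ lam ((Submodule.Quotient.mk_eq_zero _).mp h1)
  let ev : S b →ₗ[ℂ] (ℕ × ℕ →₀ ℂ) := LinearMap.applyₗ (vec (0, 0)) ∘ₗ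
    (lineRep hb₀ hb₁ hb₂ (scalK lam) (scalK' lam)).toLinearMap
  have h3 : ev (Finsupp.linearCombination ℂ g l) = l := by
    rw [Finsupp.apply_linearCombination]
    have : ev ∘ g = vec := funext fun p ↦ lineRep_monom hb₀ hb₁ hb₂ lam p
    rw [this]
    simp [Finsupp.linearCombination_apply, vec]
  rw [← h3]
  exact h2

/-- The class of `s` is `s · 1`, and `1` is the image of `vec (0, 0)` under the `S`-linear
comparison map. -/
theorem span_monom : ⊤ ≤ Submodule.span ℂ (Set.range (monom b lam)) := by
  intro y _
  obtain ⟨s, rfl⟩ := (lineIdeal b lam).mkQ_surjective y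
  rw [← Finsupp.range_linearCombination]
  refine ⟨_, (linearCombination_monom_lineRep hb₀ hb₁ hb₂ lam s (vec (0, 0))).trans ?_⟩
  simp only [vec, Finsupp.linearCombination_single, one_smul, monom, pow_zero, mul_one]
  rw [← Submodule.Quotient.mk_smul, smul_eq_mul, mul_one]
  rfl

/-- The basis `Fᵃ Tᶜ` of a line module. -/
def lineBasis : Module.Basis (ℕ × ℕ) ℂ (S b ⧸ lineIdeal b lam) :=
  Module.Basis.mk (linearIndependent_monom hb₀ hb₁ hb₂ lam) (span_monom hb₀ hb₁ hb₂ lam)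

lemma lineBasis_apply (p : ℕ × ℕ) : lineBasis hb₀ hb₁ hb₂ lam p = monom b lam p :=
  Module.Basis.mk_apply ..

end lineBasis

end DegSklyanin

theorem Module.Basis.isInternal_span_fiber {ι M : Type*} [AddCommGroup M] [Module ℂ M]
    (B : Module.Basis ι ℂ M) (deg : ι → ℕ) :
    DirectSum.IsInternal fun n ↦ Submodule.span ℂ (B '' {i | deg i = n}) := by
  refine (DirectSum.isInternal_submodule_iff_iSupIndep_and_iSup_eq_top _).mpr
    ⟨fun n ↦ ?_, ?_⟩
  · refine Disjoint.mono_right (iSup₂_le fun m hm ↦ ?_) (B.linearIndependent.disjoint_span_image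
      (s := {i | deg i = n}) (t := {i | deg i ≠ n}) ?_)
    · exact Submodule.span_mono (Set.image_mono fun i (hi : deg i = m) ↦ by simpa [hi] using hm)
    · exact disjoint_compl_right
  · rw [eq_top_iff, ← B.span_eq, Submodule.span_le]
    rintro _ ⟨i, rfl⟩
    exact Submodule.mem_iSup_of_mem (deg i) (Submodule.subset_span ⟨i, rfl, rfl⟩)

namespace DegSklyanin

/-! ### Grading, Hilbert series and criticality of the line module -/

section isLineModule

variable {b : ℂ} (hb₀ : b ≠ 0) (hb₁ : b ≠ I) (hb₂ : b ≠ -I) (lam : OnePoint ℂ)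

/-- The span of the monomials `Fᵃ Tᶜ` with `a + c = n`. -/
def layer (b : ℂ) (lam : OnePoint ℂ) (n : ℕ) : Submodule ℂ (S b ⧸ lineIdeal b lam) :=
  Submodule.span ℂ (monom b lam '' {p | p.1 + p.2 = n})

lemma monom_mem_layer {lam : OnePoint ℂ} {a c n : ℕ} (h : a + c = n) :
    monom b lam (a, c) ∈ layer b lam n :=
  Submodule.subset_span ⟨(a, c), h, rfl⟩

include hb₀ hb₁ hb₂

lemma S1_smul_monom {s : S b} (hs : s ∈ S1 b) (a c : ℕ) :
    s • monom b lam (a, c) ∈ layer b lam (a + c + 1) := by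
  refine S1_le (N := (layer b lam (a + c + 1)).comap
    ((LinearMap.toSpanSingleton (S b) _ (monom b lam (a, c))).restrictScalars ℂ))
    hb₀ hb₁ hb₂ ?_ ?_ ?_ ?_ hs
  · change (K b : S b) • monom b lam (a, c) ∈ layer b lam (a + c + 1)
    rw [K_smul_monom hb₀ hb₁ hb₂]
    exact Submodule.smul_mem _ _ (monom_mem_layer (by omega))
  · change (K' b : S b) • monom b lam (a, c) ∈ layer b lam (a + c + 1)
    rw [K'_smul_monom hb₀ hb₁ hb₂]
    exact Submodule.smul_mem _ _ (monom_mem_layer (by omega))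
  · change (E b : S b) • monom b lam (a, c) ∈ layer b lam (a + c + 1)
    rw [E_smul_monom hb₀ hb₁ hb₂]
    rcases a with - | a
    · rw [coefE_zero, zero_smul]
      exact Submodule.zero_mem _
    · exact Submodule.smul_mem _ _ (monom_mem_layer (by omega))
  · change (F b : S b) • monom b lam (a, c) ∈ layer b lam (a + c + 1)
    rw [F_smul_monom]
    exact monom_mem_layer (by omega)

lemma S1_smul_layer {s : S b} (hs : s ∈ S1 b) {n : ℕ} {m : S b ⧸ lineIdeal b lam}
    (hm : m ∈ layer b lam n) : s • m ∈ layer b lam (n + 1) := by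
  induction hm using Submodule.span_induction with
  | mem m hm =>
    obtain ⟨⟨a, c⟩, rfl, rfl⟩ := hm
    exact S1_smul_monom hb₀ hb₁ hb₂ lam hs a c
  | zero => rw [smul_zero]; exact Submodule.zero_mem _
  | add m m' _ _ h h' => rw [smul_add]; exact Submodule.add_mem _ h h'
  | smul c m _ h => rw [smul_algebra_smul_comm]; exact Submodule.smul_mem _ _ h

/-- `S₁` raises layers by one, and conversely `Fᵃ Tᶜ` is a product of `a + c` elements of `S₁`. -/
lemma quotGrading_eq_layer (n : ℕ) : quotGrading (lineIdeal b lam) n = layer b lam n := by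
  apply le_antisymm
  · rintro _ ⟨s, hs, rfl⟩
    change Submodule.Quotient.mk s ∈ _
    induction n generalizing s with
    | zero =>
      obtain ⟨r, rfl⟩ : ∃ r : ℂ, algebraMap ℂ (S b) r = s := by
        simpa [grading, Submodule.mem_one] using hs
      have h : (Submodule.Quotient.mk (algebraMap ℂ (S b) r) : S b ⧸ lineIdeal b lam) =
          r • monom b lam (0, 0) := by
        rw [monom, pow_zero, pow_zero, mul_one, ← Submodule.Quotient.mk_smul,
          Algebra.algebraMap_eq_smul_one]
      rw [h]
      exact Submodule.smul_mem _ _ (monom_mem_layer rfl)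
    | succ n ih =>
      rw [SetLike.mem_coe, grading, pow_succ'] at hs
      induction hs using Submodule.mul_induction_on' with
      | mem_mul_mem s hs t ht => exact S1_smul_layer hb₀ hb₁ hb₂ lam hs (ih t ht)
      | add s _ t _ h h' => exact Submodule.add_mem _ h h'
  · rw [layer, Submodule.span_le]
    rintro _ ⟨⟨a, c⟩, rfl, rfl⟩
    refine ⟨_, ?_, rfl⟩
    rw [SetLike.mem_coe, grading, pow_add]
    exact Submodule.mul_mem_mul (Submodule.pow_mem_pow _ (F b).2 _)
      (Submodule.pow_mem_pow _ (compl b lam).2 _)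

lemma layer_eq_span (n : ℕ) : layer b lam n = Submodule.span ℂ
    (lineBasis hb₀ hb₁ hb₂ lam '' (Finset.HasAntidiagonal.antidiagonal n : Finset (ℕ × ℕ))) := by
  have h1 : ⇑(lineBasis hb₀ hb₁ hb₂ lam) = monom b lam :=
    funext (lineBasis_apply hb₀ hb₁ hb₂ lam)
  have h2 : ((Finset.HasAntidiagonal.antidiagonal n : Finset (ℕ × ℕ)) : Set (ℕ × ℕ)) =
      {p | p.1 + p.2 = n} := by ext; simp
  rw [layer, h1, h2]

lemma finrank_layer (n : ℕ) : Module.finrank ℂ (layer b lam n) = n + 1 := by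
  rw [layer_eq_span hb₀ hb₁ hb₂, finrank_span_image_basis, Finset.Nat.card_antidiagonal]

lemma finiteDimensional_layer (n : ℕ) : FiniteDimensional ℂ (layer b lam n) := by
  rw [layer_eq_span hb₀ hb₁ hb₂]
  exact FiniteDimensional.span_of_finite ℂ (Set.toFinite _)

/-- `T` is chosen so that it acts with non-zero scalars even when `λ = 0` or `∞`, where `K` or `K'`
acts as zero. -/
theorem isCriticalModule_line : IsCriticalModule 2 (S b) (S b ⧸ lineIdeal b lam) := by
  have hq := q_ne_zero hb₁ hb₂
  refine isCriticalModule_two (lineBasis hb₀ hb₁ hb₂ lam) (adjoin_S1 b) (F := F b)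
    (T := compl b lam) (t := fun a ↦ scalF (q b) lam ^ a) (F b).2 (compl b lam).2 ?_ ?_ ?_ ?_
  · rintro x hx ⟨a, c⟩
    rw [lineBasis_apply]
    have h := S1_smul_monom hb₀ hb₁ hb₂ lam hx a c
    rw [layer_eq_span hb₀ hb₁ hb₂] at h
    refine Submodule.span_mono (Set.image_mono fun p hp ↦ ?_) h
    have : p.1 + p.2 = a + c + 1 := by simpa using hp
    exact mem_triangle.mpr this.le
  · intro a
    refine pow_ne_zero _ ?_
    cases lam with
    | infty => exact inv_ne_zero hq
    | coe μ => exact hq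
  · intro a c
    rw [lineBasis_apply, lineBasis_apply, F_smul_monom]
  · intro a c
    rw [lineBasis_apply, lineBasis_apply]
    cases lam with
    | infty => exact (K_smul_monom hb₀ hb₁ hb₂ _ a c).trans (by simp [scalK, scalF])
    | coe μ => exact (K'_smul_monom hb₀ hb₁ hb₂ _ a c).trans (by simp [scalK', scalF])

theorem isLineModule_line :
    IsLineModule (grading b) (quotGrading (lineIdeal b lam)) where
  isInternal := by
    have h : quotGrading (lineIdeal b lam) = layer b lam :=
      funext (quotGrading_eq_layer hb₀ hb₁ hb₂ lam)
    have h1 : ⇑(lineBasis hb₀ hb₁ hb₂ lam) = monom b lam :=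
      funext (lineBasis_apply hb₀ hb₁ hb₂ lam)
    have h2 := (lineBasis hb₀ hb₁ hb₂ lam).isInternal_span_fiber fun p ↦ p.1 + p.2
    rw [h1] at h2
    rw [h]
    exact h2
  smul_mem _ _ _ hs _ hm := smul_mem_quotGrading hs hm
  cyclic := by
    refine ⟨Submodule.Quotient.mk 1, ⟨1, by simpa [grading] using ⟨1, map_one _⟩, rfl⟩, eq_top_iff.mpr ?_⟩
    rintro y -
    obtain ⟨s, rfl⟩ := (lineIdeal b lam).mkQ_surjective y
    refine Submodule.mem_span_singleton.mpr ⟨s, ?_⟩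
    rw [← Submodule.Quotient.mk_smul, smul_eq_mul, mul_one]
    rfl
  finiteDimensional n := by
    rw [quotGrading_eq_layer hb₀ hb₁ hb₂]
    exact finiteDimensional_layer hb₀ hb₁ hb₂ lam n
  hilbert := by
    have hf (n : ℕ) : Module.finrank ℂ (quotGrading (lineIdeal b lam) n) = n + 1 := by
      rw [quotGrading_eq_layer hb₀ hb₁ hb₂, finrank_layer hb₀ hb₁ hb₂]
    simp only [hf]
    -- The binomial series with exponent `1 + 1`, whose coefficients are `n + 1`.
    have h := PowerSeries.mk_add_choose_mul_one_sub_pow_eq_one ℤ 1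
    simp only [Nat.choose_one_right] at h
    simpa [add_comm] using h
  critical := isCriticalModule_line hb₀ hb₁ hb₂ lam

end isLineModule

end DegSklyanin

/-! ### The algebra `U_q(sl₂)` -/

namespace Uqsl2

/-- The relations of `U_q(sl₂)`. -/
structure GenRel {A : Type*} [Ring A] [Algebra ℂ A] (q : ℂ) (e f k k' : A) : Prop where
  ke : k * e = q ^ 2 • (e * k)
  kf : k * f = (q ^ 2)⁻¹ • (f * k)
  kk' : k * k' = 1
  k'k : k' * k = 1
  ef : e * f - f * e = (q - q⁻¹)⁻¹ • (k - k')

/-- The quotient map from the free algebra. -/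
def proj (q : ℂ) : FreeAlgebra ℂ Gen →ₐ[ℂ] Uqsl2 q := RingQuot.mkAlgHom ℂ (Rel q)

lemma proj_rel {q : ℂ} {u v : FreeAlgebra ℂ Gen} (h : Rel q u v) : proj q u = proj q v :=
  RingQuot.mkAlgHom_rel ℂ h

lemma proj_G (q : ℂ) (g : Gen) : proj q (G g) = gen q g := rfl

theorem genRel (q : ℂ) : GenRel q (gen q .e) (gen q .f) (gen q .k) (gen q .kinv) where
  ke := by simpa only [map_mul, map_smul, proj_G] using proj_rel (Rel.ke (q := q))
  kf := by simpa only [map_mul, map_smul, proj_G] using proj_rel (Rel.kf (q := q))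
  kk' := by simpa only [map_mul, map_one, proj_G] using proj_rel (Rel.k_kinv (q := q))
  k'k := by simpa only [map_mul, map_one, proj_G] using proj_rel (Rel.kinv_k (q := q))
  ef := by simpa only [map_mul, map_sub, map_smul, proj_G] using proj_rel (Rel.ef (q := q))

variable {A : Type*} [Ring A] [Algebra ℂ A] {q : ℂ}

/-- The images of the generators under `lift`. -/
def liftGen (e f k k' : A) : Gen → A
  | .e => e
  | .f => f
  | .k => k
  | .kinv => k'

lemma liftGen_rel {e f k k' : A} (h : GenRel q e f k k') ⦃u v : FreeAlgebra ℂ Gen⦄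
    (huv : Rel q u v) :
    FreeAlgebra.lift ℂ (liftGen e f k k') u = FreeAlgebra.lift ℂ (liftGen e f k k') v := by
  induction huv <;> simp only [map_mul, map_smul, map_sub, map_one, FreeAlgebra.lift_ι_apply,
    liftGen]
  · exact h.ke
  · exact h.kf
  · exact h.kk'
  · exact h.k'k
  · exact h.ef

/-- The algebra homomorphism out of `U_q(sl₂)` with prescribed values on the generators. -/
def lift {e f k k' : A} (h : GenRel q e f k k') : Uqsl2 q →ₐ[ℂ] A :=
  RingQuot.liftAlgHom ℂ ⟨FreeAlgebra.lift ℂ (liftGen e f k k'), liftGen_rel h⟩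

lemma lift_gen {e f k k' : A} (h : GenRel q e f k k') (g : Gen) :
    lift h (gen q g) = liftGen e f k k' g := by
  have := RingQuot.liftAlgHom_mkAlgHom_apply ℂ (FreeAlgebra.lift ℂ (liftGen e f k k'))
    (liftGen_rel h) (G g)
  rw [FreeAlgebra.lift_ι_apply] at this
  exact this

theorem algHom_ext {φ ψ : Uqsl2 q →ₐ[ℂ] A} (h : ∀ g, φ (gen q g) = ψ (gen q g)) : φ = ψ :=
  RingQuot.ringQuot_ext' ℂ φ ψ (FreeAlgebra.hom_ext (funext h))

lemma twist_rel {z : ℂ} (hz : z ≠ 0) :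
    GenRel q (z • gen q .e) (z⁻¹ • gen q .f) (gen q .k) (gen q .kinv) := by
  obtain ⟨h1, h2, h3, h4, h5⟩ := genRel q
  refine ⟨?_, ?_, h3, h4, ?_⟩
  · rw [mul_smul_comm, h1, smul_mul_assoc, smul_comm]
  · rw [mul_smul_comm, h2, smul_mul_assoc, smul_comm]
  · rw [smul_mul_smul_comm, smul_mul_smul_comm, mul_inv_cancel₀ hz, inv_mul_cancel₀ hz, one_smul,
      one_smul, h5]

/-- The automorphism `e ↦ z e`, `f ↦ z⁻¹ f`, `k ↦ k`. -/
def twist (q : ℂ) {z : ℂ} (hz : z ≠ 0) : Uqsl2 q →ₐ[ℂ] Uqsl2 q := lift (twist_rel hz)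

lemma twist_e {z : ℂ} (hz : z ≠ 0) : twist q hz (gen q .e) = z • gen q .e := lift_gen _ _
lemma twist_f {z : ℂ} (hz : z ≠ 0) : twist q hz (gen q .f) = z⁻¹ • gen q .f := lift_gen _ _
lemma twist_k {z : ℂ} (hz : z ≠ 0) : twist q hz (gen q .k) = gen q .k := lift_gen _ _
lemma twist_kinv {z : ℂ} (hz : z ≠ 0) : twist q hz (gen q .kinv) = gen q .kinv := lift_gen _ _

lemma twist_twist_inv {z w : ℂ} (hz : z ≠ 0) (hw : w ≠ 0) (h : z * w = 1) (u : Uqsl2 q) :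
    twist q hz (twist q hw u) = u := by
  have h' : w⁻¹ * z⁻¹ = 1 := by rw [← mul_inv, mul_comm, h, inv_one]
  have : (twist q hz).comp (twist q hw) = AlgHom.id ℂ _ := by
    refine algHom_ext fun g ↦ ?_
    cases g <;> simp only [AlgHom.comp_apply, AlgHom.id_apply, twist_e, twist_f, twist_k,
      twist_kinv, map_smul, smul_smul]
    · rw [mul_comm, h, one_smul]
    · rw [h', one_smul]
  exact DFunLike.congr_fun this u

/-- The left ideal `U e + U (k - λ)`. -/
abbrev vermaIdeal (q lam : ℂ) : Ideal (Uqsl2 q) :=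
  Ideal.span {gen q .e, gen q .k - algebraMap ℂ (Uqsl2 q) lam}

/-- The twist rescales `e` and fixes `k`, so it preserves the generators up to scalars. -/
lemma twist_mem_vermaIdeal {lam z : ℂ} (hz : z ≠ 0) {u : Uqsl2 q} (hu : u ∈ vermaIdeal q lam) :
    twist q hz u ∈ vermaIdeal q lam := by
  induction hu using Submodule.span_induction with
  | mem u hu =>
    rcases hu with rfl | rfl
    · rw [twist_e, Algebra.smul_def]
      exact Ideal.mul_mem_left _ _ (Ideal.subset_span (by simp))
    · rw [map_sub, twist_k, AlgHom.commutes]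
      exact Ideal.subset_span (by simp)
  | zero => rw [map_zero]; exact Ideal.zero_mem _
  | add u v _ _ hu hv => rw [map_add]; exact Ideal.add_mem _ hu hv
  | smul a u _ hu => rw [smul_eq_mul, map_mul]; exact Ideal.mul_mem_left _ _ hu

end Uqsl2

/-! ### The degree-zero part of the localization -/

namespace DegSklyanin

section toLoc

variable {b : ℂ}

/-- The fraction `s / (K K')ⁿ`, linear in `s`. -/
def toLoc (b : ℂ) (n : ℕ) : S b →ₗ[ℂ] SLoc b where
  toFun s := OreLocalization.oreDiv s (cPow b n)
  map_add' _ _ := OreLocalization.add_oreDiv.symm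
  map_smul' z s := by
    have h0 : (1 : cPowers b) = cPow b 0 := Subtype.ext (pow_zero _).symm
    have h1 : algebraMap ℂ (SLoc b) z =
      OreLocalization.oreDiv (algebraMap ℂ (S b) z) (cPow b 0) := by rw [← h0]; rfl
    rw [RingHom.id_apply, Algebra.smul_def z (OreLocalization.oreDiv s _ : SLoc b), h1,
      Algebra.smul_def]
    exact ((oreDiv_smul_cPow _ _ 0 n).trans (by rw [zero_add]; rfl)).symm

lemma toLoc_mul (m n : ℕ) (s t : S b) : toLoc b m s * toLoc b n t = toLoc b (m + n) (s * t) :=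
  oreDiv_smul_cPow s t m n

lemma toLoc_c_pow (m n : ℕ) (s : S b) : toLoc b (m + n) (s * c b ^ n) = toLoc b m s := by
  have h : toLoc b n (c b ^ n) = 1 := OreLocalization.div_eq_one (s := cPow b n)
  rw [← toLoc_mul, h, mul_one]

lemma toLoc_c (m : ℕ) (s : S b) : toLoc b (m + 1) (s * c b) = toLoc b m s := by
  simpa using toLoc_c_pow m 1 s

lemma toLoc_pow (s : S b) (n : ℕ) : toLoc b 1 s ^ n = toLoc b n (s ^ n) := by
  induction n with
  | zero =>
    have := OreLocalization.div_eq_one (s := cPow b 0)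
    rw [pow_zero, pow_zero, ← this]
    exact congrArg (toLoc b 0) (pow_zero (c b)).symm |>.symm
  | succ n ih => rw [pow_succ, ih, toLoc_mul, pow_succ]

lemma one_eq_toLoc (n : ℕ) : (1 : SLoc b) = toLoc b n (c b ^ n) :=
  (OreLocalization.div_eq_one (s := cPow b n)).symm

lemma coe_frac (s t : S1 b) : (frac b s t : SLoc b) = toLoc b 1 ((s : S b) * t) := rfl

end toLoc

/-! ### The homomorphism from `U_q(sl₂)` and its surjectivity -/

section iso

variable {b : ℂ} (hb₀ : b ≠ 0) (hb₁ : b ≠ I) (hb₂ : b ≠ -I) {r : ℂ} (hr : r ^ 2 = q b)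

include hb₀ hb₁ hb₂ hr

/-- `K` and `K'` scale `E` and `F` by inverse powers of `q`, so `K K'⁻¹` scales them by `q^{±2}`.
Both `EK' · FK` and `FK · EK'` acquire a factor `q` when reordered; the two factors `r⁻¹` cancel it,
which is why a square root of `q` appears. -/
lemma fromU_rel : Uqsl2.GenRel (q b) (r⁻¹ • EKinv b) (r⁻¹ • FKinv' b) (KKinv' b)
    (frac b (K' b) (K' b)) := by
  have h := quantumRel b hb₀ hb₁ hb₂
  have hq := q_ne_zero hb₁ hb₂
  have hr0 : r⁻¹ * r⁻¹ = (q b)⁻¹ := by rw [← hr, ← mul_inv, sq]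
  have e2 : (1 : SLoc b) = toLoc b 2 (c b * c b) := by rw [← sq]; exact one_eq_toLoc 2
  constructor <;> apply Subtype.ext
  · simp only [MulMemClass.coe_mul, SetLike.val_smul, EKinv, KKinv', coe_frac, mul_smul_comm,
      smul_mul_assoc, toLoc_mul]
    rw [smul_comm (q b ^ 2), ← map_smul (toLoc b _) (q b ^ 2)]
    congr 2
    calc (K b : S b) * K b * (E b * K' b) = K b * (K b * E b) * K' b := by noncomm_ring
      _ = q b • (K b * E b * (K b * K' b)) := by
        conv_lhs => rw [h.ke, mul_smul_comm, smul_mul_assoc]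
        simp only [mul_assoc]
      _ = q b ^ 2 • (E b * K b * (K b * K' b)) := by
        rw [h.ke, smul_mul_assoc, smul_smul, sq]
      _ = q b ^ 2 • (E b * K' b * (K b * K b)) := by
        rw [Commute.mul_mul_mul_comm (K'_mul_K b : Commute (K' b : S b) (K b)) (E b) (K b),
          h.kk']
  · simp only [MulMemClass.coe_mul, SetLike.val_smul, FKinv', KKinv', coe_frac, mul_smul_comm,
      smul_mul_assoc, toLoc_mul]
    rw [smul_comm (q b ^ 2)⁻¹, ← map_smul (toLoc b _) (q b ^ 2)⁻¹]
    congr 2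
    calc (K b : S b) * K b * (F b * K b) = K b * (K b * F b) * K b := by noncomm_ring
      _ = (q b)⁻¹ • (K b * F b * (K b * K b)) := by
        conv_lhs => rw [h.kf, mul_smul_comm, smul_mul_assoc]
        simp only [mul_assoc]
      _ = (q b ^ 2)⁻¹ • (F b * K b * (K b * K b)) := by
        rw [h.kf, smul_mul_assoc, smul_smul, sq, mul_inv]
  · rw [MulMemClass.coe_mul, KKinv', coe_frac, coe_frac, toLoc_mul, OneMemClass.coe_one, e2]
    congr 1
    exact Commute.mul_mul_mul_comm h.kk' _ _
  · rw [MulMemClass.coe_mul, KKinv', coe_frac, coe_frac, toLoc_mul, OneMemClass.coe_one, e2]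
    congr 1
    rw [Commute.mul_mul_mul_comm (K'_mul_K b : Commute (K' b : S b) (K b)), K'_mul_K]
  · simp only [AddSubgroupClass.coe_sub, MulMemClass.coe_mul, SetLike.val_smul, EKinv, FKinv',
      KKinv', coe_frac, smul_mul_smul_comm, hr0, toLoc_mul]
    have h1 : (E b : S b) * K' b * (F b * K b) = q b • (E b * F b * c b) := by
      rw [mul_assoc, ← mul_assoc (K' b : S b), h.k'f, smul_mul_assoc, mul_smul_comm, mul_assoc,
        mul_assoc, K'_mul_K]
    have h2 : (F b : S b) * K b * (E b * K' b) = q b • (F b * E b * c b) := by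
      rw [mul_assoc, ← mul_assoc (K b : S b), h.ke, smul_mul_assoc, mul_smul_comm, mul_assoc,
        mul_assoc]
      rfl
    rw [h1, h2, map_smul, map_smul, toLoc_c, toLoc_c, inv_smul_smul₀ hq, inv_smul_smul₀ hq,
      ← map_sub, h.ef, add_sub_cancel_left, map_smul, map_sub]

/-- The algebra homomorphism `U_q(sl₂) → S[(K K')⁻¹]₀`. -/
def fromU : Uqsl2 (q b) →ₐ[ℂ] SLocZero b := Uqsl2.lift (fromU_rel hb₀ hb₁ hb₂ hr)

lemma fromU_gen (g : Uqsl2.Gen) : fromU hb₀ hb₁ hb₂ hr (Uqsl2.gen (q b) g) =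
    Uqsl2.liftGen (r⁻¹ • EKinv b) (r⁻¹ • FKinv' b) (KKinv' b) (frac b (K' b) (K' b)) g :=
  Uqsl2.lift_gen _ _

omit hb₀ in
lemma smul_r_inv (y : SLocZero b) : r • r⁻¹ • y = y := by
  refine smul_inv_smul₀ (fun h ↦ q_ne_zero hb₁ hb₂ ?_) y
  rw [← hr, h, zero_pow two_ne_zero]

/-! #### Surjectivity -/

/-- The image of `U_q(sl₂)` in `S[(K K')⁻¹]`. -/
def rangeU : Subalgebra ℂ (SLoc b) := ((SLocZero b).val.comp (fromU hb₀ hb₁ hb₂ hr)).range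

lemma coe_fromU_mem (u : Uqsl2 (q b)) :
    (fromU hb₀ hb₁ hb₂ hr u : SLoc b) ∈ rangeU hb₀ hb₁ hb₂ hr := ⟨u, rfl⟩

lemma EKinv_mem : toLoc b 1 ((E b : S b) * K' b) ∈ rangeU hb₀ hb₁ hb₂ hr := by
  have := coe_fromU_mem hb₀ hb₁ hb₂ hr (r • Uqsl2.gen _ .e)
  rw [map_smul, fromU_gen, Uqsl2.liftGen, smul_r_inv hb₁ hb₂ hr] at this
  exact this

lemma FKinv'_mem : toLoc b 1 ((F b : S b) * K b) ∈ rangeU hb₀ hb₁ hb₂ hr := by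
  have := coe_fromU_mem hb₀ hb₁ hb₂ hr (r • Uqsl2.gen _ .f)
  rw [map_smul, fromU_gen, Uqsl2.liftGen, smul_r_inv hb₁ hb₂ hr] at this
  exact this

lemma KKinv'_mem : toLoc b 1 ((K b : S b) * K b) ∈ rangeU hb₀ hb₁ hb₂ hr := by
  have := coe_fromU_mem hb₀ hb₁ hb₂ hr (Uqsl2.gen _ .k)
  rw [fromU_gen, Uqsl2.liftGen] at this
  exact this

lemma K'K'_mem : toLoc b 1 ((K' b : S b) * K' b) ∈ rangeU hb₀ hb₁ hb₂ hr := by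
  have := coe_fromU_mem hb₀ hb₁ hb₂ hr (Uqsl2.gen _ .kinv)
  rw [fromU_gen, Uqsl2.liftGen] at this
  exact this

/-- The fraction is `s K'⁻ⁿ`. Since generators commute with `K` up to scalars, `s x Kⁿ⁺¹` is a
multiple of `(s Kⁿ)(x K)`, and induction reduces to the fractions `x K'⁻¹` for `x = K, K', E, F`. -/
lemma toLoc_mul_K_pow_mem (n : ℕ) {s : S b} (hs : s ∈ grading b n) :
    toLoc b n (s * (K b : S b) ^ n) ∈ rangeU hb₀ hb₁ hb₂ hr := by
  have h := quantumRel b hb₀ hb₁ hb₂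
  have hq := q_ne_zero hb₁ hb₂
  induction n generalizing s with
  | zero =>
    obtain ⟨z, rfl⟩ : ∃ z : ℂ, algebraMap ℂ (S b) z = s := by
      simpa [grading, Submodule.mem_one] using hs
    rw [Algebra.algebraMap_eq_smul_one, smul_mul_assoc, map_smul, one_mul, ← toLoc_pow, pow_zero]
    exact Subalgebra.smul_mem _ (Subalgebra.one_mem _) z
  | succ n ih =>
    rw [grading, pow_succ] at hs
    induction hs using Submodule.mul_induction_on' with
    | add s _ t _ hs ht => rw [add_mul, map_add]; exact Subalgebra.add_mem _ hs ht
    | mem_mul_mem s hs x hx =>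
      have key : ∀ x : S b, (∃ z : ℂ, x * K b = z • ((K b : S b) * x)) →
          toLoc b 1 (x * K b) ∈ rangeU hb₀ hb₁ hb₂ hr →
          toLoc b (n + 1) (s * x * (K b : S b) ^ (n + 1)) ∈ rangeU hb₀ hb₁ hb₂ hr := by
        rintro x ⟨z, hz⟩ hx
        have : s * x * (K b : S b) ^ (n + 1) = z ^ n • (s * (K b : S b) ^ n * (x * K b)) := by
          rw [pow_succ, mul_assoc, ← mul_assoc x, pow_smul_comm hz]
          simp only [smul_mul_assoc, mul_smul_comm, mul_assoc]
        rw [this, map_smul, ← toLoc_mul]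
        exact Subalgebra.smul_mem _ (Subalgebra.mul_mem _ (ih hs) hx) _
      refine S1_le (N := (Subalgebra.toSubmodule (rangeU hb₀ hb₁ hb₂ hr)).comap
        (toLoc b (n + 1) ∘ₗ LinearMap.mulRight ℂ ((K b : S b) ^ (n + 1)) ∘ₗ LinearMap.mulLeft ℂ s))
        hb₀ hb₁ hb₂ (key (K b) ⟨1, (one_smul _ _).symm⟩ ?_) (key (K' b) ⟨1, ?_⟩ ?_)
        (key (E b) ⟨(q b)⁻¹, ?_⟩ ?_) (key (F b) ⟨q b, ?_⟩ ?_) hx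
      · exact KKinv'_mem hb₀ hb₁ hb₂ hr
      · rw [one_smul, h.kk']
      · rw [K'_mul_K, ← pow_one (c b), ← one_eq_toLoc]
        exact Subalgebra.one_mem _
      · rw [h.ke, inv_smul_smul₀ hq]
      -- `E K'⁻¹ = (E K⁻¹)(K K'⁻¹)`.
      · have h1 := Subalgebra.mul_mem _ (EKinv_mem hb₀ hb₁ hb₂ hr) (KKinv'_mem hb₀ hb₁ hb₂ hr)
        have h2 : (E b : S b) * K' b * (K b * K b) = E b * K b * c b := by
          rw [mul_assoc, ← mul_assoc (K' b : S b), K'_mul_K, c_comm, mul_assoc]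
        rwa [toLoc_mul, h2, toLoc_c] at h1
      · rw [h.kf, smul_inv_smul₀ hq]
      · exact FKinv'_mem hb₀ hb₁ hb₂ hr

/-- For `s` of degree `2n`, `s (KK')⁻ⁿ = (s K'⁻²ⁿ)(K' K⁻¹)ⁿ`, and both factors lie in the image. -/
lemma fromU_surjective : Function.Surjective (fromU hb₀ hb₁ hb₂ hr) := by
  rintro ⟨_, n, s, hs, rfl⟩
  have h1 := Subalgebra.mul_mem _ (toLoc_mul_K_pow_mem hb₀ hb₁ hb₂ hr (2 * n) hs)
    (Subalgebra.pow_mem _ (K'K'_mem hb₀ hb₁ hb₂ hr) n)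
  have h2 : (K b : S b) ^ (2 * n) * ((K' b : S b) * K' b) ^ n = c b ^ (2 * n) := by
    rw [← sq, ← pow_mul]
    exact (Commute.mul_pow (quantumRel b hb₀ hb₁ hb₂).kk' (2 * n)).symm
  rw [toLoc_pow, toLoc_mul, mul_assoc, h2, add_comm, toLoc_c_pow] at h1
  obtain ⟨u, hu⟩ := h1
  exact ⟨u, Subtype.ext hu⟩

end iso

end DegSklyanin

/-- A cyclic module is the quotient by the annihilator of a generator, along a ring
homomorphism. -/
theorem exists_addEquiv_quotient {R A M : Type*} [Ring R] [Ring A] [AddCommMonoid M] [Module A M]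
    (φ : R →+* A) (m₀ : M) {J : Ideal R} (hJ : ∀ u, φ u • m₀ = 0 ↔ u ∈ J)
    (hm₀ : ∀ m, ∃ u, φ u • m₀ = m) :
    ∃ ψ : M ≃+ R ⧸ J, ∀ (u : R) (m : M), ψ (φ u • m) = u • ψ m := by
  let _ : AddCommGroup M := Module.addCommMonoidToAddCommGroup A
  let _ : Module R M := Module.compHom M φ
  let θ : R →ₗ[R] M := LinearMap.toSpanSingleton R M m₀
  have hker : LinearMap.ker θ = J := Submodule.ext hJ
  let e : (R ⧸ J) ≃ₗ[R] M :=
    (Submodule.quotEquivOfEq _ _ hker.symm).trans (θ.quotKerEquivOfSurjective hm₀)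
  exact ⟨e.symm.toAddEquiv, fun u m ↦ e.symm.map_smul u m⟩

namespace DegSklyanin

/-! ### Injectivity, via an action of `S` on `U_q(sl₂)` -/

section injective

variable {b : ℂ} (hb₀ : b ≠ 0) (hb₁ : b ≠ I) (hb₂ : b ≠ -I) {r : ℂ} (hr : r ^ 2 = q b)

/-- The automorphism of `U_q(sl₂)` induced by conjugation with `K'`. -/
def conjK' : Uqsl2 (q b) →ₐ[ℂ] Uqsl2 (q b) :=
  Uqsl2.twist (q b) (inv_ne_zero (q_ne_zero hb₁ hb₂))

lemma conjK'_e : conjK' hb₁ hb₂ (Uqsl2.gen (q b) .e) = (q b)⁻¹ • Uqsl2.gen (q b) .e :=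
  Uqsl2.twist_e _

lemma conjK'_f : conjK' hb₁ hb₂ (Uqsl2.gen (q b) .f) = q b • Uqsl2.gen (q b) .f :=
  (Uqsl2.twist_f _).trans (by rw [inv_inv])

lemma conjK'_k : conjK' hb₁ hb₂ (Uqsl2.gen (q b) .k) = Uqsl2.gen (q b) .k :=
  Uqsl2.twist_k _

lemma conjK'_kinv : conjK' hb₁ hb₂ (Uqsl2.gen (q b) .kinv) = Uqsl2.gen (q b) .kinv :=
  Uqsl2.twist_kinv _

/-- Multiplication by `a` after conjugation by `K'`. -/
def skewMul (a : Uqsl2 (q b)) : Module.End ℂ (Uqsl2 (q b)) :=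
  LinearMap.mulLeft ℂ a ∘ₗ (conjK' hb₁ hb₂).toLinearMap

lemma skewMul_apply (a u : Uqsl2 (q b)) : skewMul hb₁ hb₂ a u = a * conjK' hb₁ hb₂ u := rfl

include hr in
-- In the skew Laurent ring with `K'` acting as `σ`, the prescribed isomorphism forces `K = k K'`,
-- `F = r f K'` and `E = (E K⁻¹)(K K'⁻¹) K' = r e k K'`.
lemma skewMul_rel : QuantumRel (q b) (skewMul hb₁ hb₂ (Uqsl2.gen (q b) .k)) (skewMul hb₁ hb₂ 1)
    (skewMul hb₁ hb₂ (r • (Uqsl2.gen (q b) .e * Uqsl2.gen (q b) .k)))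
    (skewMul hb₁ hb₂ (r • Uqsl2.gen (q b) .f)) := by
  have hq := q_ne_zero hb₁ hb₂
  obtain ⟨h1, h2, h3, h4, h5⟩ := Uqsl2.genRel (q b)
  have h5' := sub_eq_iff_eq_add.mp h5
  have hk : ∀ u : Uqsl2 (q b), Uqsl2.gen (q b) .kinv * (Uqsl2.gen (q b) .k * u) = u := fun u ↦ by
    rw [← mul_assoc, h4, one_mul]
  have h1' : ∀ u : Uqsl2 (q b), Uqsl2.gen (q b) .k * (Uqsl2.gen (q b) .e * u) =
      q b ^ 2 • (Uqsl2.gen (q b) .e * (Uqsl2.gen (q b) .k * u)) := fun u ↦ by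
    rw [← mul_assoc, h1, smul_mul_assoc, mul_assoc]
  have h2' : ∀ u : Uqsl2 (q b), Uqsl2.gen (q b) .k * (Uqsl2.gen (q b) .f * u) =
      (q b ^ 2)⁻¹ • (Uqsl2.gen (q b) .f * (Uqsl2.gen (q b) .k * u)) := fun u ↦ by
    rw [← mul_assoc, h2, smul_mul_assoc, mul_assoc]
  have h5'' : ∀ u : Uqsl2 (q b), Uqsl2.gen (q b) .e * (Uqsl2.gen (q b) .f * u) =
      (q b - (q b)⁻¹)⁻¹ • (Uqsl2.gen (q b) .k * u - Uqsl2.gen (q b) .kinv * u) +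
        Uqsl2.gen (q b) .f * (Uqsl2.gen (q b) .e * u) := fun u ↦ by
    rw [← mul_assoc, h5', add_mul, smul_mul_assoc, sub_mul, mul_assoc]
  constructor <;> refine LinearMap.ext fun u ↦ ?_ <;>
    simp only [Module.End.mul_apply, LinearMap.add_apply, LinearMap.sub_apply,
      LinearMap.smul_apply, skewMul_apply, map_mul, map_smul, conjK'_e, conjK'_f,
      conjK'_k, one_mul, smul_mul_assoc, mul_smul_comm, mul_assoc, h1', h2', h5'', hk] <;>
    match_scalars <;> field_simp <;> simp only [hr]

/-- The representation of `S` on `U_q(sl₂)` in which `K'` acts by conjugation. -/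
def skewRep : S b →ₐ[ℂ] Module.End ℂ (Uqsl2 (q b)) :=
  lift hb₀ hb₁ hb₂ (skewMul_rel hb₁ hb₂ hr)

lemma skewRep_K : skewRep hb₀ hb₁ hb₂ hr (K b) = skewMul hb₁ hb₂ (Uqsl2.gen (q b) .k) :=
  lift_K ..

lemma skewRep_K' : skewRep hb₀ hb₁ hb₂ hr (K' b) = skewMul hb₁ hb₂ 1 :=
  lift_K' ..

lemma skewRep_E : skewRep hb₀ hb₁ hb₂ hr (E b) =
    skewMul hb₁ hb₂ (r • (Uqsl2.gen (q b) .e * Uqsl2.gen (q b) .k)) := lift_E ..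

lemma skewRep_F : skewRep hb₀ hb₁ hb₂ hr (F b) = skewMul hb₁ hb₂ (r • Uqsl2.gen (q b) .f) :=
  lift_F ..

lemma skewRep_c_apply (u : Uqsl2 (q b)) : skewRep hb₀ hb₁ hb₂ hr (c b) u =
    Uqsl2.gen (q b) .k * conjK' hb₁ hb₂ (conjK' hb₁ hb₂ u) := by
  rw [c, map_mul, Module.End.mul_apply, skewRep_K, skewRep_K', skewMul_apply, skewMul_apply,
    one_mul]

/-- The inverse of `conjK'`. -/
def conjK'Inv : Uqsl2 (q b) →ₐ[ℂ] Uqsl2 (q b) := Uqsl2.twist (q b) (q_ne_zero hb₁ hb₂)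

lemma conjK'Inv_conjK' (u : Uqsl2 (q b)) : conjK'Inv hb₁ hb₂ (conjK' hb₁ hb₂ u) = u :=
  Uqsl2.twist_twist_inv _ _ (mul_inv_cancel₀ (q_ne_zero hb₁ hb₂)) u

lemma conjK'_conjK'Inv (u : Uqsl2 (q b)) : conjK' hb₁ hb₂ (conjK'Inv hb₁ hb₂ u) = u :=
  Uqsl2.twist_twist_inv _ _ (inv_mul_cancel₀ (q_ne_zero hb₁ hb₂)) u

/-- The inverse of the action of `K K'`. -/
def skewRepCInv : Module.End ℂ (Uqsl2 (q b)) :=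
  (conjK'Inv hb₁ hb₂).toLinearMap ∘ₗ (conjK'Inv hb₁ hb₂).toLinearMap ∘ₗ
    LinearMap.mulLeft ℂ (Uqsl2.gen (q b) .kinv)

lemma skewRepCInv_apply (u : Uqsl2 (q b)) : skewRepCInv hb₁ hb₂ u =
    conjK'Inv hb₁ hb₂ (conjK'Inv hb₁ hb₂ (Uqsl2.gen (q b) .kinv * u)) := rfl

lemma skewRepCInv_c (u : Uqsl2 (q b)) :
    skewRepCInv hb₁ hb₂ (skewRep hb₀ hb₁ hb₂ hr (c b) u) = u := by
  rw [skewRepCInv_apply, skewRep_c_apply, ← mul_assoc, (Uqsl2.genRel (q b)).k'k, one_mul,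
    conjK'Inv_conjK', conjK'Inv_conjK']

/-- `K K'` acts as left multiplication by `k` after `σ²`, and both are invertible. -/
lemma isUnit_skewRep_c : IsUnit (skewRep hb₀ hb₁ hb₂ hr (c b)) := by
  refine ⟨⟨skewRep hb₀ hb₁ hb₂ hr (c b), skewRepCInv hb₁ hb₂, LinearMap.ext fun u ↦ ?_,
    LinearMap.ext fun u ↦ skewRepCInv_c hb₀ hb₁ hb₂ hr u⟩, rfl⟩
  rw [Module.End.mul_apply, skewRepCInv_apply, skewRep_c_apply, conjK'_conjK'Inv,
    conjK'_conjK'Inv, ← mul_assoc, (Uqsl2.genRel (q b)).kk', one_mul]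
  rfl

lemma isUnit_skewRep_cPowers (d : cPowers b) :
    IsUnit ((skewRep hb₀ hb₁ hb₂ hr : S b →* Module.End ℂ (Uqsl2 (q b))).comp
      (cPowers b).subtype d) := by
  obtain ⟨_, n, rfl⟩ := d
  simpa using (isUnit_skewRep_c hb₀ hb₁ hb₂ hr).pow n

/-- The extension of `skewRep` to the localization. -/
def skewRepLoc : SLoc b →+* Module.End ℂ (Uqsl2 (q b)) :=
  OreLocalization.universalHom (skewRep hb₀ hb₁ hb₂ hr).toRingHom
    (IsUnit.liftRight _ (isUnit_skewRep_cPowers hb₀ hb₁ hb₂ hr)) fun d ↦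
      (IsUnit.coe_liftRight _ (isUnit_skewRep_cPowers hb₀ hb₁ hb₂ hr) d).symm

lemma skewRep_c_pow_mul (n : ℕ) (s : S b) :
    skewRep hb₀ hb₁ hb₂ hr (c b ^ n) * skewRepLoc hb₀ hb₁ hb₂ hr (toLoc b n s) =
      skewRep hb₀ hb₁ hb₂ hr s := by
  have h : skewRep hb₀ hb₁ hb₂ hr (c b ^ n) =
      IsUnit.liftRight _ (isUnit_skewRep_cPowers hb₀ hb₁ hb₂ hr) (cPow b n) :=
    (IsUnit.coe_liftRight _ (isUnit_skewRep_cPowers hb₀ hb₁ hb₂ hr) (cPow b n)).symm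
  have h2 : skewRepLoc hb₀ hb₁ hb₂ hr (toLoc b n s) = _ := OreLocalization.universalHom_apply ..
  rw [h2, h, Units.mul_inv_cancel_left]
  rfl

/-- The action of a fraction is determined after multiplying by its denominator, which acts
invertibly. -/
lemma skewRepLoc_eq {n : ℕ} {s : S b} {x : Module.End ℂ (Uqsl2 (q b))}
    (h : skewRep hb₀ hb₁ hb₂ hr s = skewRep hb₀ hb₁ hb₂ hr (c b ^ n) * x) :
    skewRepLoc hb₀ hb₁ hb₂ hr (toLoc b n s) = x := by
  rw [← skewRep_c_pow_mul, map_pow] at h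
  exact ((isUnit_skewRep_c hb₀ hb₁ hb₂ hr).pow n).mul_left_cancel h

/-- The representation of `S[(K K')⁻¹]₀` on `U_q(sl₂)`. -/
def skewRepZero : SLocZero b →ₐ[ℂ] Module.End ℂ (Uqsl2 (q b)) :=
  { (skewRepLoc hb₀ hb₁ hb₂ hr).comp (SLocZero b).val.toRingHom with
    commutes' := fun z ↦ by
      change skewRepLoc hb₀ hb₁ hb₂ hr (algebraMap ℂ (SLoc b) z) = _
      rw [Algebra.algebraMap_eq_smul_one, one_eq_toLoc 0, ← map_smul]
      refine skewRepLoc_eq hb₀ hb₁ hb₂ hr ?_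
      rw [pow_zero, map_smul, map_one, one_mul, Algebra.algebraMap_eq_smul_one] }

lemma skewRepZero_frac {s t : S1 b} {x : Module.End ℂ (Uqsl2 (q b))}
    (h : ∀ u, skewRep hb₀ hb₁ hb₂ hr s (skewRep hb₀ hb₁ hb₂ hr t u) =
      skewRep hb₀ hb₁ hb₂ hr (c b) (x u)) :
    skewRepZero hb₀ hb₁ hb₂ hr (frac b s t) = x := by
  refine skewRepLoc_eq hb₀ hb₁ hb₂ hr (n := 1) (LinearMap.ext fun u ↦ ?_)
  rw [map_mul, pow_one]
  exact h u

/-- Numerator and denominator of a degree-zero fraction carry the same power of `σ`, so only a left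
multiplication survives; checking generators is enough. Evaluation at `1` then recovers `u`, whence
injectivity. -/
theorem skewRepZero_fromU (u : Uqsl2 (q b)) :
    skewRepZero hb₀ hb₁ hb₂ hr (fromU hb₀ hb₁ hb₂ hr u) = LinearMap.mulLeft ℂ u := by
  have hq := q_ne_zero hb₁ hb₂
  have hr0 : r ≠ 0 := fun h ↦ hq (by rw [← hr, h, zero_pow two_ne_zero])
  obtain ⟨h1, h2, h3, h4, -⟩ := Uqsl2.genRel (q b)
  have hl (a u : Uqsl2 (q b)) : Algebra.lmul ℂ (Uqsl2 (q b)) a u = a * u := rfl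
  have hext : (skewRepZero hb₀ hb₁ hb₂ hr).comp (fromU hb₀ hb₁ hb₂ hr) =
      Algebra.lmul ℂ (Uqsl2 (q b)) := by
    refine Uqsl2.algHom_ext fun g ↦ ?_
    rw [AlgHom.comp_apply, fromU_gen]
    have hE : skewRepZero hb₀ hb₁ hb₂ hr (EKinv b) =
        r • Algebra.lmul ℂ (Uqsl2 (q b)) (Uqsl2.gen (q b) .e) := by
      refine skewRepZero_frac hb₀ hb₁ hb₂ hr fun u ↦ ?_
      simp only [skewRep_E, skewRep_K', skewRep_c_apply, skewMul_apply, one_mul,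
        LinearMap.smul_apply, hl, map_smul, map_mul, conjK'_e, smul_mul_assoc,
        mul_smul_comm, ← mul_assoc, h1, smul_smul]
      congr 1
      field_simp
    have hF : skewRepZero hb₀ hb₁ hb₂ hr (FKinv' b) =
        r • Algebra.lmul ℂ (Uqsl2 (q b)) (Uqsl2.gen (q b) .f) := by
      refine skewRepZero_frac hb₀ hb₁ hb₂ hr fun u ↦ ?_
      simp only [skewRep_F, skewRep_K, skewRep_c_apply, skewMul_apply,
        LinearMap.smul_apply, hl, map_smul, map_mul, conjK'_f, conjK'_k,
        smul_mul_assoc, mul_smul_comm, ← mul_assoc, h2, smul_smul]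
      congr 1
      field_simp
    cases g with
    | e => rw [Uqsl2.liftGen, map_smul, hE, inv_smul_smul₀ hr0]
    | f => rw [Uqsl2.liftGen, map_smul, hF, inv_smul_smul₀ hr0]
    | k =>
      refine skewRepZero_frac hb₀ hb₁ hb₂ hr fun u ↦ ?_
      simp only [skewRep_K, skewRep_c_apply, skewMul_apply, hl, map_mul, conjK'_k]
    | kinv =>
      refine skewRepZero_frac hb₀ hb₁ hb₂ hr fun u ↦ ?_
      simp only [skewRep_K', skewRep_c_apply, skewMul_apply, hl, map_mul,
        conjK'_kinv, one_mul, ← mul_assoc, h3]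
  exact DFunLike.congr_fun hext u

theorem fromU_injective : Function.Injective (fromU hb₀ hb₁ hb₂ hr) := by
  intro u v huv
  have h := congrArg (fun y ↦ skewRepZero hb₀ hb₁ hb₂ hr y 1) huv
  simpa [skewRepZero_fromU] using h

/-- The isomorphism `U_q(sl₂) ≅ S[(K K')⁻¹]₀`. -/
def equivU : Uqsl2 (q b) ≃ₐ[ℂ] SLocZero b :=
  AlgEquiv.ofBijective (fromU hb₀ hb₁ hb₂ hr)
    ⟨fromU_injective hb₀ hb₁ hb₂ hr, fromU_surjective hb₀ hb₁ hb₂ hr⟩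

end injective

/-! ### The Verma modules -/

section verma

variable {b : ℂ} (hb₀ : b ≠ 0) (hb₁ : b ≠ I) (hb₂ : b ≠ -I) {r : ℂ} (hr : r ^ 2 = q b) (μ : ℂ)

lemma conjK'_mem_vermaIdeal {u : Uqsl2 (q b)} (hu : u ∈ Uqsl2.vermaIdeal (q b) μ) :
    conjK' hb₁ hb₂ u ∈ Uqsl2.vermaIdeal (q b) μ := Uqsl2.twist_mem_vermaIdeal _ hu

/-- The generators act by `σ` followed by a left multiplication; a left ideal stable under `σ`
absorbs both. -/
lemma skewRep_mem_vermaIdeal (s : S b) {u : Uqsl2 (q b)} (hu : u ∈ Uqsl2.vermaIdeal (q b) μ) :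
    skewRep hb₀ hb₁ hb₂ hr s u ∈ Uqsl2.vermaIdeal (q b) μ := by
  let J := Uqsl2.vermaIdeal (q b) μ
  let B : Subalgebra ℂ (S b) :=
    { carrier := {s | ∀ u ∈ J, skewRep hb₀ hb₁ hb₂ hr s u ∈ J}
      mul_mem' := fun {s t} hs ht u hu ↦ by
        rw [map_mul, Module.End.mul_apply]; exact hs _ (ht _ hu)
      add_mem' := fun {s t} hs ht u hu ↦ by
        rw [map_add, LinearMap.add_apply]; exact J.add_mem (hs _ hu) (ht _ hu)
      algebraMap_mem' := fun z u hu ↦ by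
        rw [AlgHom.commutes, Module.algebraMap_end_apply, Algebra.smul_def]
        exact J.mul_mem_left _ hu }
  have key : ∀ a u, u ∈ J → skewMul hb₁ hb₂ a u ∈ J := fun a u hu ↦
    J.mul_mem_left _ (conjK'_mem_vermaIdeal hb₁ hb₂ μ hu)
  have hB : B = ⊤ := by
    refine subalgebra_eq_top hb₀ hb₁ hb₂ ?_ ?_ ?_ ?_ <;> intro u hu
    · rw [skewRep_K]; exact key _ u hu
    · rw [skewRep_K']; exact key _ u hu
    · rw [skewRep_E]; exact key _ u hu
    · rw [skewRep_F]; exact key _ u hu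
  exact (hB ▸ Algebra.mem_top : s ∈ B) u hu

/-- `E · 1 = r e k` is a multiple of `k e`, and `(K - μK') · 1 = k - μ`. -/
lemma skewRep_one_mem {s : S b} (hs : s ∈ lineIdeal b (μ : OnePoint ℂ)) :
    skewRep hb₀ hb₁ hb₂ hr s 1 ∈ Uqsl2.vermaIdeal (q b) μ := by
  have hq := q_ne_zero hb₁ hb₂
  induction hs using Submodule.span_induction with
  | mem s hs =>
    rcases hs with rfl | rfl
    · have h : Uqsl2.gen (q b) .e * Uqsl2.gen (q b) .k =
          (q b ^ 2)⁻¹ • (Uqsl2.gen (q b) .k * Uqsl2.gen (q b) .e) := by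
        rw [(Uqsl2.genRel (q b)).ke, inv_smul_smul₀ (pow_ne_zero 2 hq)]
      rw [skewRep_E, skewMul_apply, map_one, mul_one, h, smul_smul, ← smul_mul_assoc]
      exact Ideal.mul_mem_left _ _ (Ideal.subset_span (by simp))
    · change skewRep hb₀ hb₁ hb₂ hr ((K b : S b) - μ • (K' b : S b)) 1 ∈ _
      rw [map_sub, map_smul, skewRep_K, skewRep_K', LinearMap.sub_apply, LinearMap.smul_apply,
        skewMul_apply, skewMul_apply, map_one, mul_one, mul_one, ← Algebra.algebraMap_eq_smul_one]
      exact Ideal.subset_span (by simp)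
  | zero => rw [map_zero, LinearMap.zero_apply]; exact Ideal.zero_mem _
  | add s t _ _ hs ht => rw [map_add, LinearMap.add_apply]; exact Ideal.add_mem _ hs ht
  | smul a s _ hs =>
    rw [smul_eq_mul, map_mul, Module.End.mul_apply]
    exact skewRep_mem_vermaIdeal hb₀ hb₁ hb₂ hr μ a hs

/-- The inverse of `K K'` acts by `k⁻¹` and twists, which also preserve the Verma ideal. -/
lemma mem_vermaIdeal_of_skewRep_c_pow (n : ℕ) {u : Uqsl2 (q b)}
    (hu : skewRep hb₀ hb₁ hb₂ hr (c b ^ n) u ∈ Uqsl2.vermaIdeal (q b) μ) :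
    u ∈ Uqsl2.vermaIdeal (q b) μ := by
  induction n with
  | zero => simpa using hu
  | succ n ih =>
    refine ih ?_
    rw [pow_succ', map_mul, Module.End.mul_apply] at hu
    rw [← skewRepCInv_c hb₀ hb₁ hb₂ hr (skewRep hb₀ hb₁ hb₂ hr (c b ^ n) u)]
    exact Uqsl2.twist_mem_vermaIdeal _ (Uqsl2.twist_mem_vermaIdeal _ (Ideal.mul_mem_left _ _ hu))

/-- The generator `1` of the degree-zero part of the localized line module. -/
def vermaGen {b : ℂ} (J : Ideal (S b)) : quotLocZero J :=
  ⟨OreLocalization.oreDiv (Submodule.Quotient.mk 1) (cPow b 0), 0, Submodule.Quotient.mk 1,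
    ⟨1, by simpa [grading] using ⟨1, map_one _⟩, rfl⟩, rfl⟩

lemma smul_vermaGen {J : Ideal (S b)} {y : SLocZero b} {n : ℕ} {s : S b}
    (h : (y : SLoc b) = toLoc b n s) : ((y • vermaGen J : quotLocZero J) : quotLoc J) =
      OreLocalization.oreDiv (Submodule.Quotient.mk s) (cPow b n) := by
  change (y : SLoc b) • (OreLocalization.oreDiv (Submodule.Quotient.mk 1) (cPow b 0) : quotLoc J) = _
  rw [h]
  refine (oreDiv_smul_cPow s (Submodule.Quotient.mk 1) n 0).trans ?_
  rw [← Submodule.Quotient.mk_smul, smul_eq_mul, mul_one, add_zero]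

lemma smul_vermaGen_surjective (J : Ideal (S b)) (m : quotLocZero J) :
    ∃ y : SLocZero b, y • vermaGen J = m := by
  obtain ⟨_, n, _, ⟨s, hs, rfl⟩, rfl⟩ := m
  exact ⟨⟨toLoc b n s, n, s, hs, rfl⟩, Subtype.ext (smul_vermaGen rfl)⟩

lemma frac_smul_vermaGen_eq_zero {J : Ideal (S b)} {y : SLocZero b} {n : ℕ} {s : S b}
    (h : (y : SLoc b) = toLoc b n s) (hs : s ∈ J) : y • vermaGen J = 0 := by
  refine Subtype.ext ((smul_vermaGen h).trans ?_)
  rw [(Submodule.Quotient.mk_eq_zero J).mpr hs, OreLocalization.zero_oreDiv]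
  rfl

/-- Write the image of `u` as `s (KK')⁻ⁿ`. If it kills the generator, some `(KK')ᵐ s` lies in the
line ideal, so applying it to `1` puts `(KK')ᵐ⁺ⁿ · u` in the Verma ideal, and `K K'` can be
cancelled. The converse uses `E K' = q K' E` and `K² - μ K K' = K (K - μK')`. -/
lemma fromU_smul_vermaGen_eq_zero_iff (u : Uqsl2 (q b)) :
    fromU hb₀ hb₁ hb₂ hr u • vermaGen (lineIdeal b (μ : OnePoint ℂ)) = 0 ↔
      u ∈ Uqsl2.vermaIdeal (q b) μ := by
  have hrel := quantumRel b hb₀ hb₁ hb₂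
  have hq := q_ne_zero hb₁ hb₂
  constructor
  · intro h
    obtain ⟨n, s, hs, hus⟩ := (fromU hb₀ hb₁ hb₂ hr u).2
    have hus' : (fromU hb₀ hb₁ hb₂ hr u : SLoc b) = toLoc b n s := hus
    have h1 := (smul_vermaGen hus').symm.trans (congrArg Subtype.val h)
    have h2 : (OreLocalization.oreDiv (Submodule.Quotient.mk s) (cPow b n) :
        quotLoc (lineIdeal b (μ : OnePoint ℂ))) = OreLocalization.oreDiv 0 1 :=
      h1.trans (OreLocalization.zero_oreDiv 1).symm
    -- Equality of Ore fractions gives `v` with `v s` in the line ideal and `v (KK')ⁿ = (KK')ᵐ`;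
    -- centrality then yields `(KK')ᵐ s = (KK')ⁿ v s`.
    obtain ⟨⟨_, m, rfl⟩, v, hv1, hv2⟩ := OreLocalization.oreDiv_eq_iff.mp h2
    have hvs : v * s ∈ lineIdeal b (μ : OnePoint ℂ) := by
      rw [← Submodule.Quotient.mk_eq_zero, ← smul_eq_mul, Submodule.Quotient.mk_smul, ← hv1,
        smul_zero]
    have hcs : c b ^ m * s ∈ lineIdeal b (μ : OnePoint ℂ) := by
      have h3 : c b ^ m = v * c b ^ n := by simpa [cPow] using hv2
      have h4 : v * c b ^ n = c b ^ n * v := (cPowers_comm b (cPow b n) v).symm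
      rw [h3, h4, mul_assoc]
      exact Ideal.mul_mem_left _ _ hvs
    have h5 := skewRep_one_mem hb₀ hb₁ hb₂ hr μ hcs
    have h6 : skewRepLoc hb₀ hb₁ hb₂ hr (toLoc b n s) = LinearMap.mulLeft ℂ u := by
      rw [← skewRepZero_fromU hb₀ hb₁ hb₂ hr u, ← hus']
      rfl
    rw [map_mul, ← skewRep_c_pow_mul hb₀ hb₁ hb₂ hr n s, h6, ← mul_assoc, ← map_mul, ← pow_add,
      Module.End.mul_apply, LinearMap.mulLeft_apply, mul_one] at h5
    exact mem_vermaIdeal_of_skewRep_c_pow hb₀ hb₁ hb₂ hr μ _ h5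
  · intro hu
    induction hu using Submodule.span_induction with
    | mem u hu =>
      rcases hu with rfl | rfl
      · rw [fromU_gen, Uqsl2.liftGen]
        refine frac_smul_vermaGen_eq_zero (n := 1) (s := r⁻¹ • ((E b : S b) * K' b)) ?_ ?_
        · rw [map_smul]; rfl
        · have h : (E b : S b) * K' b = q b • ((K' b : S b) * E b) := by
            rw [hrel.k'e, smul_inv_smul₀ hq]
          rw [h, smul_smul, ← smul_mul_assoc]
          exact Ideal.mul_mem_left _ _ (Ideal.subset_span (by simp))
      · rw [map_sub, fromU_gen, Uqsl2.liftGen, AlgHom.commutes]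
        refine frac_smul_vermaGen_eq_zero (n := 1)
          (s := (K b : S b) * ((K b : S b) - μ • (K' b : S b))) ?_ ?_
        · rw [mul_sub, map_sub, mul_smul_comm, map_smul, ← c, ← pow_one (c b), ← one_eq_toLoc,
            ← Algebra.algebraMap_eq_smul_one]
          rfl
        · exact Ideal.mul_mem_left _ _ (Ideal.subset_span (Set.mem_insert_of_mem _ rfl))
    | zero => rw [map_zero, zero_smul]
    | add u v _ _ hu hv => rw [map_add, add_smul, hu, hv, add_zero]
    | smul a u _ hu => rw [smul_eq_mul, map_mul, mul_smul, hu, smul_zero]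

/-- The degree-zero part of the localized line module is the Verma module. -/
theorem exists_vermaEquiv :
    ∃ ψ : quotLocZero (lineIdeal b (μ : OnePoint ℂ)) ≃+ Uqsl2.Verma (q b) μ,
      ∀ (a : SLocZero b) (m : quotLocZero (lineIdeal b (μ : OnePoint ℂ))),
        ψ (a • m) = (equivU hb₀ hb₁ hb₂ hr).symm a • ψ m := by
  obtain ⟨ψ, hψ⟩ := exists_addEquiv_quotient (equivU hb₀ hb₁ hb₂ hr : Uqsl2 (q b) →+* SLocZero b)
    (vermaGen (lineIdeal b (μ : OnePoint ℂ)))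
    (fromU_smul_vermaGen_eq_zero_iff hb₀ hb₁ hb₂ hr μ) (fun m ↦ by
      obtain ⟨y, rfl⟩ := smul_vermaGen_surjective _ m
      obtain ⟨u, rfl⟩ := fromU_surjective hb₀ hb₁ hb₂ hr y
      exact ⟨u, rfl⟩)
  refine ⟨ψ, fun a m ↦ ?_⟩
  rw [← hψ]
  congr 2
  exact ((equivU hb₀ hb₁ hb₂ hr).apply_symm_apply a).symm

end verma

end DegSklyanin

end

/-! ### Assembly of the three assertions -/

theorem mainTheorem8 (b : ℂ) (hb₀ : b ≠ 0) (hb₁ : b ≠ Complex.I) (hb₂ : b ≠ -Complex.I)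
    (lam : OnePoint ℂ) :
    -- `ℓ` is a line in `ℙ(S₁*)`, and it lies on the quadric `Q(λ)`
    (Module.finrank ℂ (DegSklyanin.line b lam) = 2 ∧
      ∀ p : Projectivization ℂ (Module.Dual ℂ (DegSklyanin.S1 b)),
        p.submodule ≤ DegSklyanin.line b lam → p ∈ DegSklyanin.quadric b lam) ∧
    -- `S / S ℓ^⊥` is a line module
    IsLineModule (DegSklyanin.grading b)
      (DegSklyanin.quotGrading (DegSklyanin.perpIdeal b (DegSklyanin.line b lam))) ∧
    -- `(S / S ℓ^⊥)[(K K')⁻¹]₀ ≅ M(λ)` along the isomorphism `Φ : S[(K K')⁻¹]₀ ≅ U_q(sl₂)` given by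
    -- `E K⁻¹ ↦ √q e`, `F K'⁻¹ ↦ √q f`, `K K'⁻¹ ↦ k`, for either choice `r` of `√q`
    ∀ μ : ℂ, μ ≠ 0 → lam = (μ : OnePoint ℂ) →
      ∀ r : ℂ, r ^ 2 = DegSklyanin.q b →
        ∃ Φ : DegSklyanin.SLocZero b ≃ₐ[ℂ] Uqsl2 (DegSklyanin.q b),
          Φ (DegSklyanin.EKinv b) = r • Uqsl2.gen (DegSklyanin.q b) .e ∧
          Φ (DegSklyanin.FKinv' b) = r • Uqsl2.gen (DegSklyanin.q b) .f ∧
          Φ (DegSklyanin.KKinv' b) = Uqsl2.gen (DegSklyanin.q b) .k ∧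
          ∃ ψ : DegSklyanin.quotLocZero (DegSklyanin.perpIdeal b (DegSklyanin.line b lam)) ≃+
              Uqsl2.Verma (DegSklyanin.q b) μ,
            ∀ (a : DegSklyanin.SLocZero b)
              (m : DegSklyanin.quotLocZero (DegSklyanin.perpIdeal b (DegSklyanin.line b lam))),
              ψ (a • m) = Φ a • ψ m := by
  refine ⟨⟨DegSklyanin.finrank_line hb₀ hb₂ lam, fun p hp ↦ DegSklyanin.mem_quadric_of_le_line hp⟩,
    ?_, ?_⟩
  · rw [DegSklyanin.perpIdeal_line]
    exact DegSklyanin.isLineModule_line hb₀ hb₁ hb₂ lam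
  · rintro μ - rfl r hr
    have hr0 : r ≠ 0 := fun h ↦
      DegSklyanin.q_ne_zero hb₁ hb₂ (by rw [← hr, h, zero_pow two_ne_zero])
    rw [DegSklyanin.perpIdeal_line]
    refine ⟨(DegSklyanin.equivU hb₀ hb₁ hb₂ hr).symm, ?_, ?_, ?_,
      DegSklyanin.exists_vermaEquiv hb₀ hb₁ hb₂ hr μ⟩ <;> rw [AlgEquiv.symm_apply_eq]
    · rw [map_smul]
      exact ((congrArg (r • ·) (DegSklyanin.fromU_gen hb₀ hb₁ hb₂ hr .e)).trans
        (smul_inv_smul₀ hr0 _)).symm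
    · rw [map_smul]
      exact ((congrArg (r • ·) (DegSklyanin.fromU_gen hb₀ hb₁ hb₂ hr .f)).trans
        (smul_inv_smul₀ hr0 _)).symm
    · exact (DegSklyanin.fromU_gen hb₀ hb₁ hb₂ hr .k).symm
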